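/- Let $\mathcal G$ be the space of Lipschitz functions $f:\mathbb R\to\mathbb R$ with best Lipschitz constant $L_f=\sup_{x\ne y}|f(x)-f(y)|/|x-y|$, with the norm $\|f\|_{\mathrm{Lip}}=|f(0)|+L_f$ and its Borel $\sigma$-algebra, and let $\nu$ be a probability measure on $\mathcal G$ such that, for $f$ distributed according to $\nu$, $\mathbf E L_f<\infty$ and $\mathbf E|f(z)-z|<\infty$ for some $z\in\mathbb R$. Let $\Phi(p)=\mathbf E L_f^p$, and let $p\in(0,1]$ satisfy $\Phi(p)<1$ (by Jensen's inequality this implies $\mathbf E\log L_f<0$). Let $(f_k,U_k)_{k\ge1}$ be an i.i.d. sequence in which $f_k$ has distribution $\nu$, $U_k$ is uniform on $[0,1]$, and $f_k,U_k$ are independent. For $x\in(0,1]$ let $f_{k,x}=f_k$ if $U_k\le x$, and let $f_{k,x}$ be the identity otherwise. Fix $z_0\in\mathbb R$ and put $$\zeta(x)=\lim_{n\to\infty} f_{1,x}\circ\cdots\circ f_{n,x}(z_0),\qquad x\in(0,1].$$ Let $h:[0,1]\to\mathbb R$ be continuous with $\int_0^1|h(t)|^p\,t^{-1}\,dt<\infty$.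 For $0<a<b\le1$ put $$\int_{(a,b]}h\,d\zeta=\sum_{k:\,U_k\in(a,b]}h(U_k)\bigl(\zeta(U_k)-\zeta(U_k-)\bigr),\qquad \int_{(a,b]}\zeta\,dh=\zeta(b)h(b)-\zeta(a)h(a)-\int_{(a,b]}h\,d\zeta .$$ Then: (0) these objects are well defined: almost surely, the limit defining $\zeta(x)$ and the left limit $\zeta(x-)$ exist for all $x\in(0,1]$ simultaneously, and the series $\sum_{k:\,U_k\in(a,1]}h(U_k)(\zeta(U_k)-\zeta(U_k-))$ converges absolutely for all $a\in(0,1]$; (1) for every $b\in(0,1]$, $\int_{(a,b]}h\,d\zeta$ converges as $a\downarrow0$, almost surely and in $L^p$, to one and the same random variable; (2) for every $b\in(0,1]$, $\int_{(a,b]}\zeta\,dh$ converges in $L^p$ as $a\downarrow0$. Here $X_a\to Y$ in $L^p$ means that $Y$ and (for all small $a>0$) $X_a$ have finite $p$-th absolute moments and $\mathbf E|X_a-Y|^p\to0$. -/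

import Mathlib

open MeasureTheory ProbabilityTheory Filter Topology

noncomputable section

/-! ### The space of Lipschitz functions on the line -/

/-- A Lipschitz function `ℝ → ℝ`. -/
structure LipFun where
  /-- the underlying function -/
  toFun : ℝ → ℝ
  lipschitz : ∃ K : NNReal, LipschitzWith K toFun

namespace LipFun

instance : CoeFun LipFun (fun _ => ℝ → ℝ) := ⟨LipFun.toFun⟩

/-- The difference quotient `|f y - f x| / |x - y|` at a pair of distinct points. -/
def quot (f : ℝ → ℝ) (q : {q : ℝ × ℝ // q.1 ≠ q.2}) : ℝ :=
  |f q.1.2 - f q.1.1| / |q.1.1 - q.1.2|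

/-- The best Lipschitz constant `L_f = sup_{x ≠ y} |f y - f x| / |x - y|`. -/
def lipConst (f : ℝ → ℝ) : ℝ := ⨆ q, quot f q

/-- The Lipschitz norm `‖f‖_Lip = |f 0| + L_f`. -/
def normLip (f : ℝ → ℝ) : ℝ := |f 0| + lipConst f

theorem quot_nonneg (f : ℝ → ℝ) (q) : 0 ≤ quot f q := by
  unfold quot; positivity

theorem lipConst_nonneg (f : ℝ → ℝ) : 0 ≤ lipConst f :=
  Real.iSup_nonneg (quot_nonneg f)

theorem bddAbove_quot {f : ℝ → ℝ} (hf : ∃ K : NNReal, LipschitzWith K f) :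
    BddAbove (Set.range (quot f)) := by
  obtain ⟨K, hK⟩ := hf
  refine ⟨K, ?_⟩
  rintro _ ⟨⟨⟨x, y⟩, hxy⟩, rfl⟩
  have h := hK.dist_le_mul y x
  have hpos : 0 < |x - y| := abs_pos.2 (sub_ne_zero.2 hxy)
  rw [Real.dist_eq, Real.dist_eq, abs_sub_comm y x] at h
  exact (div_le_iff₀ hpos).2 h

instance : Nonempty {q : ℝ × ℝ // q.1 ≠ q.2} := ⟨⟨(0, 1), by norm_num⟩⟩

theorem lipConst_add_le {f g : ℝ → ℝ} (hf : ∃ K : NNReal, LipschitzWith K f)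
    (hg : ∃ K : NNReal, LipschitzWith K g) :
    lipConst (f + g) ≤ lipConst f + lipConst g := by
  refine ciSup_le fun q => ?_
  refine le_trans ?_ (add_le_add (le_ciSup (bddAbove_quot hf) q) (le_ciSup (bddAbove_quot hg) q))
  unfold quot
  rw [← add_div]
  gcongr
  have : (f + g) q.1.2 - (f + g) q.1.1 = (f q.1.2 - f q.1.1) + (g q.1.2 - g q.1.1) := by
    simp only [Pi.add_apply]; ring
  rw [this]
  exact abs_add_le _ _

theorem lipConst_neg (f : ℝ → ℝ) : lipConst (-f) = lipConst f := by
  unfold lipConst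
  congr 1
  ext q
  unfold quot
  have : (-f) q.1.2 - (-f) q.1.1 = -(f q.1.2 - f q.1.1) := by
    simp only [Pi.neg_apply]; ring
  rw [this, abs_neg]

theorem lipConst_zero : lipConst 0 = 0 := by
  simp [lipConst, quot]

theorem abs_sub_le_lipConst {f : ℝ → ℝ} (hf : ∃ K : NNReal, LipschitzWith K f) (x y : ℝ) :
    |f y - f x| ≤ lipConst f * |x - y| := by
  by_cases hxy : x = y
  · simp [hxy]
  · have hpos : 0 < |x - y| := abs_pos.2 (sub_ne_zero.2 hxy)
    exact (div_le_iff₀ hpos).1 (le_ciSup (bddAbove_quot hf) ⟨(x, y), hxy⟩)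

theorem lipschitz_sub (f g : LipFun) :
    ∃ K : NNReal, LipschitzWith K (f.toFun - g.toFun) := by
  obtain ⟨K, hK⟩ := f.lipschitz
  obtain ⟨M, hM⟩ := g.lipschitz
  exact ⟨K + M, hK.sub hM⟩

/-- The distance `‖f - g‖_Lip`. -/
instance : MetricSpace LipFun where
  dist f g := normLip (f.toFun - g.toFun)
  dist_self f := by simp [normLip, lipConst_zero]
  dist_comm f g := by
    have h : f.toFun - g.toFun = -(g.toFun - f.toFun) := by simp
    change normLip (f.toFun - g.toFun) = normLip (g.toFun - f.toFun)
    rw [h, normLip, normLip, lipConst_neg, Pi.neg_apply, abs_neg]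
  dist_triangle f g k := by
    have h : f.toFun - k.toFun = (f.toFun - g.toFun) + (g.toFun - k.toFun) := by simp
    change normLip (f.toFun - k.toFun) ≤ normLip (f.toFun - g.toFun) + normLip (g.toFun - k.toFun)
    rw [h, normLip, normLip, normLip]
    have h1 := lipConst_add_le (lipschitz_sub f g) (lipschitz_sub g k)
    have h2 := abs_add_le ((f.toFun - g.toFun) 0) ((g.toFun - k.toFun) 0)
    rw [Pi.add_apply]
    linarith
  eq_of_dist_eq_zero := by
    intro f g h
    change normLip (f.toFun - g.toFun) = 0 at h
    unfold normLip at h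
    have h1 := lipConst_nonneg (f.toFun - g.toFun)
    have h2 := abs_nonneg ((f.toFun - g.toFun) 0)
    have h3 : lipConst (f.toFun - g.toFun) = 0 := by linarith
    have h4 : (f.toFun - g.toFun) 0 = 0 := abs_eq_zero.1 (by linarith)
    have h5 : ∀ x, (f.toFun - g.toFun) x = 0 := by
      intro x
      have := abs_sub_le_lipConst (lipschitz_sub f g) 0 x
      rw [h3, h4, zero_mul, sub_zero] at this
      exact abs_eq_zero.1 (le_antisymm this (abs_nonneg _))
    cases f
    cases g
    congr 1
    ext x
    exact sub_eq_zero.1 (h5 x)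

/-- `LipFun` carries the Borel `σ`-algebra of the Lipschitz norm. -/
instance : MeasurableSpace LipFun := borel LipFun

instance : BorelSpace LipFun := ⟨rfl⟩

/-- The Lipschitz constant `L_f` of an element of the space. -/
def L (f : LipFun) : ℝ := lipConst f.toFun

end LipFun

/-! ### Sieved backward iterations

All objects below are defined pathwise, for a sequence `f` of Lipschitz functions and a sequence
`u` of points; index `k : ℕ` stands for the `(k+1)`-st function. -/

/-- `f_x = f` if `u ≤ x`, and the identity otherwise. -/
def sieve (f : LipFun) (u x : ℝ) : ℝ → ℝ := fun z => if u ≤ x then f z else z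

/-- The backward iteration `f_{1,x} ∘ ⋯ ∘ f_{n,x}`. -/
def backIter (f : ℕ → LipFun) (u : ℕ → ℝ) (x : ℝ) : ℕ → ℝ → ℝ
  | 0 => id
  | n + 1 => backIter f u x n ∘ sieve (f n) (u n) x

/-- `ζ(x)`, the limit of `f_{1,x} ∘ ⋯ ∘ f_{n,x} (z₀)` as `n → ∞`. -/
def zeta (f : ℕ → LipFun) (u : ℕ → ℝ) (z₀ x : ℝ) : ℝ :=
  limUnder atTop (fun n => backIter f u x n z₀)

/-- The jump `ζ(x) - ζ(x-)`. -/
def zetaJump (f : ℕ → LipFun) (u : ℕ → ℝ) (z₀ x : ℝ) : ℝ :=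
  zeta f u z₀ x - Function.leftLim (zeta f u z₀) x

/-- `∫_{(a,b]} h dζ = ∑_{k : u_k ∈ (a,b]} h(u_k) (ζ(u_k) - ζ(u_k-))`. -/
def integralDZeta (f : ℕ → LipFun) (u : ℕ → ℝ) (z₀ : ℝ) (h : ℝ → ℝ) (a b : ℝ) : ℝ :=
  ∑' k, (Set.Ioc a b).indicator (fun y => h y * zetaJump f u z₀ y) (u k)

/-- `∫_{(a,b]} ζ dh`, defined through integration by parts. -/
def integralZetaD (f : ℕ → LipFun) (u : ℕ → ℝ) (z₀ : ℝ) (h : ℝ → ℝ) (a b : ℝ) : ℝ :=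
  zeta f u z₀ b * h b - zeta f u z₀ a * h a - integralDZeta f u z₀ h a b

/-- `X a → Y` in `L^p` as `a ↓ 0`: all variables (for small `a > 0`) are in `L^p`, and
`E |X a - Y|^p → 0`. -/
def TendstoLpAtZero {Ω : Type*} [MeasurableSpace Ω] (P : Measure Ω) (p : ℝ)
    (X : ℝ → Ω → ℝ) (Y : Ω → ℝ) : Prop :=
  (∀ᶠ a in 𝓝[>] (0 : ℝ), MemLp (X a) (ENNReal.ofReal p) P) ∧
  MemLp Y (ENNReal.ofReal p) P ∧
  Tendsto (fun a => ∫⁻ ω, ENNReal.ofReal (|X a ω - Y ω| ^ p) ∂P) (𝓝[>] (0 : ℝ)) (𝓝 0)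

end

open scoped ENNReal
open LipFun

/-! ### Powers with exponent at most one -/

/-! Since `p ≤ 1`, the map `t ↦ t ^ p` is subadditive, so every estimate is made on `p`-th powers,
where sums stay sums and Lipschitz constants multiply. Independence then turns products into powers
of one-step means. A map sieved at level `x` has mean modulus `Φ x + (1 - x) = 1 - x (1 - Φ)`, so
the geometric series over the number of outer maps sums to `1 / (x (1 - Φ))`.

Convergence. In a backward iteration the new map acts innermost, so the `n`-th increment is at most
the product of the first `n` moduli times the displacement of `z₀` by the next map. On a short
interval `[c, d]` these moduli have a common majorant of mean at most `Φ d + 1 - c`, which is below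
1 when `c > Φ d`. Countably many such intervals cover `(0, 1]`, giving a single null set for all `x`
(`ae_isRegularAt`). Uniform domination also gives left limits.

Moments of `ζ`. The displacement at level `x` has mean proportional to `x`, which cancels the `1 /
x` of the geometric series, so `ζ(x)` is bounded in `L^p` uniformly in `x`.

Jumps. The jump at `U k` is the effect of deleting the `k`-th map: the inner tails coincide, and the
`k` outer maps multiply the discrepancy by at most their moduli. Given `U k = x`, the `p`-th power
of the jump has mean at most a constant times `(1 - x (1 - Φ)) ^ k`. Summing over `k` leaves `1 /
x`, so `E ∑ |h(U k)|^p |jump|^p` is at most a constant times `∫ |h|^p dx / x`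
(`lintegral_tsum_mul_jumpBound`). This gives absolute convergence and the claims on `∫ h dζ`.

For `∫ ζ dh` there remains the boundary term `ζ(a) h(a)`. Integrability of `|h|^p / t` forces `h 0 =
0`, and the uniform moment bound on `ζ(a)` makes the term vanish in `L^p`. -/

theorem ENNReal.rpow_finsetSum_le {ι : Type*} (s : Finset ι) (x : ι → ℝ≥0∞) {p : ℝ} (hp0 : 0 < p)
    (hp1 : p ≤ 1) : (∑ i ∈ s, x i) ^ p ≤ ∑ i ∈ s, x i ^ p := by
  classical
  induction s using Finset.induction_on with
  | empty => simp [hp0]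
  | insert i s hi ih =>
    rw [Finset.sum_insert hi, Finset.sum_insert hi]
    exact (ENNReal.rpow_add_le_add_rpow _ _ hp0.le hp1).trans (by gcongr)

theorem ENNReal.tsum_le_tsum_rpow {ι : Type*} (x : ι → ℝ≥0∞) {p : ℝ} (hp0 : 0 < p)
    (hp1 : p ≤ 1) : ∑' i, x i ≤ (∑' i, x i ^ p) ^ p⁻¹ := by
  rw [ENNReal.tsum_eq_iSup_sum]
  refine iSup_le fun s => ?_
  rw [ENNReal.le_rpow_inv_iff hp0]
  exact (ENNReal.rpow_finsetSum_le s x hp0 hp1).trans (ENNReal.sum_le_tsum s)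

theorem ENNReal.rpow_tsum_le {ι : Type*} (x : ι → ℝ≥0∞) {p : ℝ} (hp0 : 0 < p)
    (hp1 : p ≤ 1) : (∑' i, x i) ^ p ≤ ∑' i, x i ^ p := by
  rw [← ENNReal.le_rpow_inv_iff hp0]
  exact ENNReal.tsum_le_tsum_rpow x hp0 hp1

theorem enorm_add_rpow_le (a b : ℝ) {p : ℝ} (hp0 : 0 < p) (hp1 : p ≤ 1) :
    ‖a + b‖ₑ ^ p ≤ ‖a‖ₑ ^ p + ‖b‖ₑ ^ p :=
  (ENNReal.rpow_le_rpow (enorm_add_le a b) hp0.le).trans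
    (ENNReal.rpow_add_le_add_rpow _ _ hp0.le hp1)

theorem enorm_sub_rpow_le_add (a b : ℝ) {p : ℝ} (hp0 : 0 < p) (hp1 : p ≤ 1) :
    ‖a - b‖ₑ ^ p ≤ ‖a‖ₑ ^ p + ‖b‖ₑ ^ p := by
  simpa [sub_eq_add_neg] using enorm_add_rpow_le a (-b) hp0 hp1

theorem enorm_sub_rpow_triangle (a b c : ℝ) {p : ℝ} (hp0 : 0 < p) (hp1 : p ≤ 1) :
    ‖a - c‖ₑ ^ p ≤ ‖a - b‖ₑ ^ p + ‖b - c‖ₑ ^ p := by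
  simpa using enorm_add_rpow_le (a - b) (b - c) hp0 hp1

/-- The inclusion of `ℓ^p` in `ℓ^1` applied to `b n ^ p⁻¹`; it converts control of `p`-th powers
into control of distances. -/
theorem tsum_rpow_inv_ne_top {b : ℕ → ℝ≥0∞} (hb : ∑' n, b n ≠ ∞) {p : ℝ} (hp0 : 0 < p)
    (hp1 : p ≤ 1) : ∑' n, b n ^ p⁻¹ ≠ ∞ := by
  refine ne_top_of_le_ne_top ?_ (ENNReal.tsum_le_tsum_rpow (fun n => b n ^ p⁻¹) hp0 hp1)
  refine ENNReal.rpow_ne_top_of_nonneg (by positivity) ?_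
  simpa [← ENNReal.rpow_mul, hp0.ne'] using hb

/-- If the `p`-th powers of the increments of a sequence are dominated by a summable sequence, the
sequence converges, at a rate depending only on the dominating sequence. -/
theorem exists_tendsto_of_enorm_rpow_le {b : ℕ → ℝ≥0∞} (hb : ∑' n, b n ≠ ∞) {p : ℝ} (hp0 : 0 < p)
    (hp1 : p ≤ 1) {a : ℕ → ℝ} (ha : ∀ n, ‖a (n + 1) - a n‖ₑ ^ p ≤ b n) :
    ∃ l, Tendsto a atTop (𝓝 l) ∧ ∀ n, edist (a n) l ≤ ∑' m, b (m + n) ^ p⁻¹ := by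
  have hd : ∀ n, edist (a n) (a n.succ) ≤ b n ^ p⁻¹ := fun n => by
    rw [edist_comm, edist_eq_enorm_sub, ENNReal.le_rpow_inv_iff hp0]
    exact ha n
  obtain ⟨l, hl⟩ := cauchySeq_tendsto_of_complete
    (cauchySeq_of_edist_le_of_tsum_ne_top _ hd (tsum_rpow_inv_ne_top hb hp0 hp1))
  refine ⟨l, hl, fun n => ?_⟩
  simpa only [add_comm] using edist_le_tsum_of_edist_le_of_tendsto _ hd hl n

/-- Interchange of limits for functions whose increments are uniformly dominated. -/
theorem tendsto_limit_of_enorm_rpow_le {b : ℕ → ℝ≥0∞} (hb : ∑' n, b n ≠ ∞) {p : ℝ} (hp0 : 0 < p)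
    (hp1 : p ≤ 1) {X : Type*} {s : Set X} {F : Filter X} (hF : s ∈ F) {a : ℕ → X → ℝ}
    (ha : ∀ x ∈ s, ∀ n, ‖a (n + 1) x - a n x‖ₑ ^ p ≤ b n) {g : X → ℝ}
    (hg : ∀ x ∈ s, Tendsto (fun n => a n x) atTop (𝓝 (g x))) {L : ℕ → ℝ} {l : ℝ}
    (hL : ∀ n, Tendsto (a n) F (𝓝 (L n))) (hl : Tendsto L atTop (𝓝 l)) :
    Tendsto g F (𝓝 l) := by
  -- The tail of the dominating series does not depend on `x`, so the convergence is uniform on `s`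
  -- and the two limits may be exchanged.
  have hu : TendstoUniformlyOn a g atTop s := by
    rw [EMetric.tendstoUniformlyOn_iff]
    intro ε hε
    have := (ENNReal.tendsto_sum_nat_add _ (tsum_rpow_inv_ne_top hb hp0 hp1)).eventually
      (gt_mem_nhds hε)
    filter_upwards [this] with n hn x hx
    obtain ⟨l', hl', hle⟩ := exists_tendsto_of_enorm_rpow_le hb hp0 hp1
      (a := fun n => a n x) (ha x hx)
    rw [tendsto_nhds_unique (hg x hx) hl', edist_comm]
    exact (hle n).trans_lt hn
  exact (hu.tendstoUniformlyOnFilter.mono_right (le_principal_iff.2 hF)).tendsto_of_eventually_tendsto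
    (Eventually.of_forall hL) hl

/-! ### Backward compositions -/

/-- The composition `g 0 ∘ ⋯ ∘ g (n - 1)`. -/
def backComp (g : ℕ → ℝ → ℝ) : ℕ → ℝ → ℝ
  | 0 => id
  | n + 1 => backComp g n ∘ g n

theorem backComp_add (g : ℕ → ℝ → ℝ) (m n : ℕ) (z : ℝ) :
    backComp g (m + n) z = backComp g m (backComp (fun j => g (m + j)) n z) := by
  induction n generalizing z with
  | zero => rfl
  | succ n ih => exact ih _

theorem backComp_congr {g g' : ℕ → ℝ → ℝ} {n : ℕ} (h : ∀ k < n, g k = g' k) :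
    backComp g n = backComp g' n := by
  induction n with
  | zero => rfl
  | succ n ih =>
    change backComp g n ∘ g n = backComp g' n ∘ g' n
    rw [ih fun k hk => h k (hk.trans n.lt_succ_self), h n n.lt_succ_self]

section backComp

variable {p : ℝ} {g : ℕ → ℝ → ℝ} {α : ℕ → ℝ≥0∞}

theorem enorm_backComp_sub_rpow_le (hα : ∀ k z w, ‖g k z - g k w‖ₑ ^ p ≤ α k * ‖z - w‖ₑ ^ p)
    (n : ℕ) (z w : ℝ) :
    ‖backComp g n z - backComp g n w‖ₑ ^ p ≤ (∏ k ∈ Finset.range n, α k) * ‖z - w‖ₑ ^ p := by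
  induction n generalizing z w with
  | zero => simp [backComp]
  | succ n ih =>
    refine (ih (g n z) (g n w)).trans ?_
    rw [Finset.prod_range_succ, mul_assoc]
    gcongr
    exact hα n z w

/-- The new map acts innermost: going from `n` to `n + 1` changes only the argument of a fixed outer
composition. -/
theorem enorm_backComp_succ_sub_rpow_le
    (hα : ∀ k z w, ‖g k z - g k w‖ₑ ^ p ≤ α k * ‖z - w‖ₑ ^ p) (n : ℕ) (z : ℝ) :
    ‖backComp g (n + 1) z - backComp g n z‖ₑ ^ p ≤
      (∏ k ∈ Finset.range n, α k) * ‖g n z - z‖ₑ ^ p :=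
  enorm_backComp_sub_rpow_le hα n (g n z) z

/-- Telescoping over the increments. The bound is free of `n`, hence survives the passage to the
limit. -/
theorem enorm_backComp_sub_self_rpow_le (hp0 : 0 < p) (hp1 : p ≤ 1)
    (hα : ∀ k z w, ‖g k z - g k w‖ₑ ^ p ≤ α k * ‖z - w‖ₑ ^ p) (n : ℕ) (z : ℝ) :
    ‖backComp g n z - z‖ₑ ^ p ≤ ∑' m, (∏ k ∈ Finset.range m, α k) * ‖g m z - z‖ₑ ^ p := by
  refine le_trans ?_ (ENNReal.sum_le_tsum (Finset.range n))
  induction n with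
  | zero => simp [backComp, hp0]
  | succ n ih =>
    rw [Finset.sum_range_succ, add_comm (∑ _ ∈ _, _)]
    refine (enorm_sub_rpow_triangle _ (backComp g n z) _ hp0 hp1).trans ?_
    gcongr
    exact enorm_backComp_succ_sub_rpow_le hα n z

/-- Two backward compositions which differ only in that one of the maps is replaced by the
identity. -/
theorem enorm_backComp_sub_backComp_rpow_le (hp0 : 0 < p) (hp1 : p ≤ 1)
    (hα : ∀ k z w, ‖g k z - g k w‖ₑ ^ p ≤ α k * ‖z - w‖ₑ ^ p) {g' : ℕ → ℝ → ℝ} {k : ℕ}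
    (hne : ∀ j, j ≠ k → g' j = g j) (hk : g' k = id) (m : ℕ) (z : ℝ) :
    ‖backComp g (k + 1 + m) z - backComp g' (k + 1 + m) z‖ₑ ^ p ≤
      (∏ j ∈ Finset.range k, α j) * (‖g k z - z‖ₑ ^ p + (α k + 1) *
        ∑' i, (∏ j ∈ Finset.range i, α (k + 1 + j)) * ‖g (k + 1 + i) z - z‖ₑ ^ p) := by
  have h1 : (fun j => g' (k + 1 + j)) = fun j => g (k + 1 + j) :=
    funext fun j => hne _ (by omega)
  rw [backComp_add g (k + 1), backComp_add g' (k + 1), h1]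
  -- Beyond index `k` the sequences agree, so both compositions reach the same point `w`; then one
  -- applies `g k`, the other nothing, and the `k` outer maps are common.
  set w := backComp (fun j => g (k + 1 + j)) m z with hw
  have h2 : backComp g' (k + 1) w = backComp g k w := by
    change backComp g' k (g' k w) = _
    rw [hk, backComp_congr fun j hj => hne j hj.ne]
    rfl
  rw [h2]
  refine (enorm_backComp_succ_sub_rpow_le hα k w).trans ?_
  gcongr
  have h3 : ‖w - z‖ₑ ^ p ≤ _ := enorm_backComp_sub_self_rpow_le hp0 hp1
    (g := fun j => g (k + 1 + j)) (fun j => hα (k + 1 + j)) m z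
  -- The displacement at `w` is traded for the one at the fixed point of reference `z`, at the cost
  -- of the factor `α k + 1` on the distance from `w` to `z`.
  calc ‖g k w - w‖ₑ ^ p
      ≤ ‖g k w - g k z‖ₑ ^ p + (‖g k z - z‖ₑ ^ p + ‖z - w‖ₑ ^ p) :=
        (enorm_sub_rpow_triangle _ (g k z) _ hp0 hp1).trans
          (by gcongr; exact enorm_sub_rpow_triangle _ z _ hp0 hp1)
    _ ≤ α k * ‖w - z‖ₑ ^ p + (‖g k z - z‖ₑ ^ p + ‖w - z‖ₑ ^ p) := by
        rw [← enorm_neg (z - w), neg_sub]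
        gcongr
        exact hα k w z
    _ = ‖g k z - z‖ₑ ^ p + (α k + 1) * ‖w - z‖ₑ ^ p := by ring
    _ ≤ _ := by gcongr

end backComp

/-! ### Thinned iterations -/

namespace LipFun

/-- The `p`-th power of the Lipschitz constant. -/
noncomputable def modulus (p : ℝ) (f : LipFun) : ℝ≥0∞ := ENNReal.ofReal f.L ^ p

/-- The `p`-th power of the displacement of `z`. -/
noncomputable def displacement (p z : ℝ) (f : LipFun) : ℝ≥0∞ := ‖f z - z‖ₑ ^ p

theorem L_nonneg (f : LipFun) : 0 ≤ f.L := lipConst_nonneg _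

theorem enorm_sub_rpow_le {p : ℝ} (hp0 : 0 < p) (f : LipFun) (z w : ℝ) :
    ‖f z - f w‖ₑ ^ p ≤ modulus p f * ‖z - w‖ₑ ^ p := by
  rw [modulus, ← ENNReal.mul_rpow_of_nonneg _ _ hp0.le]
  refine ENNReal.rpow_le_rpow ?_ hp0.le
  rw [Real.enorm_eq_ofReal_abs, Real.enorm_eq_ofReal_abs, ← ENNReal.ofReal_mul f.L_nonneg,
    abs_sub_comm z w]
  exact ENNReal.ofReal_le_ofReal (abs_sub_le_lipConst f.lipschitz w z)

end LipFun


open Classical in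
/-- The sequence `f` with all maps whose index is not in `s` replaced by the identity. -/
noncomputable def thin (s : Set ℕ) (f : ℕ → LipFun) (k : ℕ) : ℝ → ℝ :=
  if k ∈ s then f k else id

open Classical in
/-- The `p`-th power of the Lipschitz constant of `thin s f k`. -/
noncomputable def thinModulus (p : ℝ) (s : Set ℕ) (f : ℕ → LipFun) (k : ℕ) : ℝ≥0∞ :=
  if k ∈ s then modulus p (f k) else 1

theorem enorm_thin_sub_rpow_le {p : ℝ} (hp0 : 0 < p) (s : Set ℕ) (f : ℕ → LipFun) (k : ℕ)
    (z w : ℝ) :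
    ‖thin s f k z - thin s f k w‖ₑ ^ p ≤ thinModulus p s f k * ‖z - w‖ₑ ^ p := by
  unfold thin thinModulus
  split_ifs
  · exact enorm_sub_rpow_le hp0 _ z w
  · simp

/-- Thinning by an index set lets the conditions `u k ≤ x` and `u k < x`, the latter for left
limits, be treated by the same bounds. -/
theorem backIter_eq_backComp (f : ℕ → LipFun) (u : ℕ → ℝ) (x : ℝ) (n : ℕ) :
    backIter f u x n = backComp (thin {k | u k ≤ x} f) n := by
  induction n with
  | zero => rfl
  | succ n ih =>
    change backIter f u x n ∘ sieve (f n) (u n) x = _ ∘ _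
    rw [ih]
    congr 1
    ext z
    by_cases h : u n ≤ x <;> simp [sieve, thin, h]

/-- The backward iteration which uses the maps with `u k < x` only. -/
noncomputable def backIterLeft (f : ℕ → LipFun) (u : ℕ → ℝ) (x : ℝ) (n : ℕ) : ℝ → ℝ :=
  backComp (thin {k | u k < x} f) n

/-- A bound for the `p`-th power of the Lipschitz constant of the sieved map, uniform for
`x ∈ [c, d]`. -/
noncomputable def maxModulus (p c d : ℝ) (y : LipFun × ℝ) : ℝ≥0∞ :=
  if y.2 ≤ c then modulus p y.1 else if y.2 ≤ d then max (modulus p y.1) 1 else 1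

/-- The series that dominates the increments of the backward iterations for all `x ∈ [c, d]`. -/
noncomputable def domSeries (p z₀ c d : ℝ) (f : ℕ → LipFun) (u : ℕ → ℝ) (n : ℕ) : ℝ≥0∞ :=
  (∏ k ∈ Finset.range n, maxModulus p c d (f k, u k)) * displacement p z₀ (f n)

/-! ### Pathwise convergence, left limits and jump bounds. -/

section pathwise

variable {p z₀ : ℝ} {f : ℕ → LipFun} {u : ℕ → ℝ}

/-- Maps with `u k ≤ c` are certainly used and those with `u k > d` certainly not; in between, the
maximum with 1 covers both cases. -/
theorem enorm_backComp_thin_rpow_le_domSeries (hp0 : 0 < p) {c d : ℝ} {s : Set ℕ}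
    (hc : {k | u k ≤ c} ⊆ s) (hd : s ⊆ {k | u k ≤ d}) (n : ℕ) :
    ‖backComp (thin s f) (n + 1) z₀ - backComp (thin s f) n z₀‖ₑ ^ p ≤
      domSeries p z₀ c d f u n := by
  refine (enorm_backComp_succ_sub_rpow_le (enorm_thin_sub_rpow_le hp0 s f) n z₀).trans ?_
  refine mul_le_mul' (Finset.prod_le_prod' fun k _ => ?_) ?_
  · unfold thinModulus maxModulus
    by_cases h1 : u k ≤ c
    · simp [h1, hc h1]
    · by_cases h2 : u k ≤ d
      · by_cases h3 : k ∈ s <;> simp [h1, h2, h3]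
      · have h3 : k ∉ s := fun h => h2 (hd h)
        simp [h1, h2, h3]
  · unfold thin displacement
    split_ifs
    · rfl
    · simp [hp0]

/-- The points near which the backward iterations converge uniformly from the left. -/
def IsRegularAt (p z₀ : ℝ) (f : ℕ → LipFun) (u : ℕ → ℝ) (x : ℝ) : Prop :=
  ∃ c d, c < x ∧ x ≤ d ∧ ∑' n, domSeries p z₀ c d f u n ≠ ∞

theorem IsRegularAt.tendsto_zeta (hp0 : 0 < p) (hp1 : p ≤ 1) {x : ℝ}
    (h : IsRegularAt p z₀ f u x) :
    Tendsto (fun n => backIter f u x n z₀) atTop (𝓝 (zeta f u z₀ x)) := by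
  obtain ⟨c, d, hc, hd, hs⟩ := h
  have h1 : ∀ n, ‖backIter f u x (n + 1) z₀ - backIter f u x n z₀‖ₑ ^ p ≤
      domSeries p z₀ c d f u n := fun n => by
    rw [backIter_eq_backComp, backIter_eq_backComp]
    exact enorm_backComp_thin_rpow_le_domSeries hp0 (fun k hk => le_trans hk hc.le)
      (fun k hk => le_trans hk hd) n
  obtain ⟨l, hl, -⟩ := exists_tendsto_of_enorm_rpow_le hs hp0 hp1
    (a := fun n => backIter f u x n z₀) h1
  exact tendsto_nhds_limUnder ⟨l, hl⟩

theorem eventually_le_iff_lt_nhdsLT (v x : ℝ) : ∀ᶠ y in 𝓝[<] x, (v ≤ y ↔ v < x) := by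
  by_cases h : v < x
  · filter_upwards [Ioo_mem_nhdsLT h] with y hy
    exact ⟨fun _ => h, fun _ => hy.1.le⟩
  · filter_upwards [self_mem_nhdsWithin] with y hy
    exact ⟨fun h' => h'.trans_lt hy, fun h' => absurd h' h⟩

/-- For fixed `n` only finitely many `u k` matter, so the iterate at `y` equals the left iterate
once `y < x` is close to `x`. Domination on `[c, d]` with `c < x` then allows the exchange of
limits. -/
theorem IsRegularAt.exists_tendsto_left (hp0 : 0 < p) (hp1 : p ≤ 1) {x : ℝ}
    (h : IsRegularAt p z₀ f u x) :
    ∃ l, Tendsto (fun n => backIterLeft f u x n z₀) atTop (𝓝 l) ∧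
      Tendsto (zeta f u z₀) (𝓝[<] x) (𝓝 l) := by
  obtain ⟨c, d, hc, hd, hs⟩ := h
  have h1 : ∀ n, ‖backIterLeft f u x (n + 1) z₀ - backIterLeft f u x n z₀‖ₑ ^ p ≤
      domSeries p z₀ c d f u n := fun n =>
    enorm_backComp_thin_rpow_le_domSeries hp0 (fun k hk => lt_of_le_of_lt hk hc)
      (fun k hk => le_trans (le_of_lt hk) hd) n
  obtain ⟨l, hl, -⟩ := exists_tendsto_of_enorm_rpow_le hs hp0 hp1
    (a := fun n => backIterLeft f u x n z₀) h1
  refine ⟨l, hl, tendsto_limit_of_enorm_rpow_le hs hp0 hp1 (s := Set.Ioo c x)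
    (Ioo_mem_nhdsLT hc) (a := fun n y => backIter f u y n z₀) ?_ ?_ ?_ hl⟩
  · intro y hy n
    simp only [backIter_eq_backComp]
    exact enorm_backComp_thin_rpow_le_domSeries hp0 (fun k hk => le_trans hk hy.1.le)
      (fun k hk => le_trans hk (hy.2.le.trans hd)) n
  · exact fun y hy => IsRegularAt.tendsto_zeta hp0 hp1 ⟨c, d, hy.1, hy.2.le.trans hd, hs⟩
  · intro n
    refine tendsto_const_nhds.congr' ?_
    have : ∀ᶠ y in 𝓝[<] x, ∀ k ∈ Finset.range n, (u k ≤ y ↔ u k < x) :=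
      (Filter.eventually_all_finset _).2 fun k _ => eventually_le_iff_lt_nhdsLT (u k) x
    filter_upwards [this] with y hy
    rw [backIter_eq_backComp, backIterLeft]
    refine congrFun (backComp_congr fun k hk => ?_) z₀
    unfold thin
    simp only [Set.mem_ofPred_eq, hy k (Finset.mem_range.2 hk)]

theorem IsRegularAt.tendsto_zetaJump (hp0 : 0 < p) (hp1 : p ≤ 1) {x : ℝ}
    (h : IsRegularAt p z₀ f u x) :
    Tendsto (fun n => backIter f u x n z₀ - backIterLeft f u x n z₀) atTop
      (𝓝 (zetaJump f u z₀ x)) := by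
  obtain ⟨l, hl, hl'⟩ := h.exists_tendsto_left hp0 hp1
  rw [zetaJump, leftLim_eq_of_tendsto hl']
  exact (h.tendsto_zeta hp0 hp1).sub hl

/-- The `p`-th power of the Lipschitz constant of `sieve y.1 y.2 x`. -/
noncomputable def sieveModulus (p x : ℝ) (y : LipFun × ℝ) : ℝ≥0∞ :=
  if y.2 ≤ x then modulus p y.1 else 1

/-- The `p`-th power of the displacement of `z` under `sieve y.1 y.2 x`. -/
noncomputable def sieveDisplacement (p z x : ℝ) (y : LipFun × ℝ) : ℝ≥0∞ :=
  if y.2 ≤ x then displacement p z y.1 else 0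

theorem thinModulus_eq_sieveModulus (x : ℝ) (k : ℕ) :
    thinModulus p {k | u k ≤ x} f k = sieveModulus p x (f k, u k) := by
  unfold thinModulus sieveModulus
  simp only [Set.mem_ofPred_eq]

theorem enorm_thin_sub_self_rpow (hp0 : 0 < p) (x : ℝ) (k : ℕ) :
    ‖thin {k | u k ≤ x} f k z₀ - z₀‖ₑ ^ p = sieveDisplacement p z₀ x (f k, u k) := by
  unfold thin sieveDisplacement displacement
  by_cases h : u k ≤ x <;> simp [h, hp0]

theorem IsRegularAt.enorm_zeta_sub_rpow_le (hp0 : 0 < p) (hp1 : p ≤ 1) {x : ℝ}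
    (h : IsRegularAt p z₀ f u x) :
    ‖zeta f u z₀ x - z₀‖ₑ ^ p ≤ ∑' n, (∏ k ∈ Finset.range n, sieveModulus p x (f k, u k)) *
      sieveDisplacement p z₀ x (f n, u n) := by
  have h1 : Tendsto (fun n => ‖backIter f u x n z₀ - z₀‖ₑ ^ p) atTop
      (𝓝 (‖zeta f u z₀ x - z₀‖ₑ ^ p)) :=
    (((h.tendsto_zeta hp0 hp1).sub_const z₀).enorm).ennrpow_const p
  refine le_of_tendsto' h1 fun n => ?_
  rw [backIter_eq_backComp]
  refine (enorm_backComp_sub_self_rpow_le hp0 hp1 (enorm_thin_sub_rpow_le hp0 _ f) n z₀).trans_eq ?_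
  simp only [thinModulus_eq_sieveModulus, enorm_thin_sub_self_rpow hp0]

/-- A bound for the `p`-th power of the jump of `ζ` at `u k`. -/
noncomputable def jumpBound (p z₀ : ℝ) (f : ℕ → LipFun) (u : ℕ → ℝ) (k : ℕ) : ℝ≥0∞ :=
  (∏ j ∈ Finset.range k, sieveModulus p (u k) (f j, u j)) *
    (displacement p z₀ (f k) + (modulus p (f k) + 1) *
      ∑' i, (∏ j ∈ Finset.range i, sieveModulus p (u k) (f (k + 1 + j), u (k + 1 + j))) *
        sieveDisplacement p z₀ (u k) (f (k + 1 + i), u (k + 1 + i)))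

/-- As the points are distinct, the iterations at `u k` and just left of it differ in the `k`-th map
alone. -/
theorem IsRegularAt.enorm_zetaJump_rpow_le (hp0 : 0 < p) (hp1 : p ≤ 1)
    (hu : Function.Injective u) {k : ℕ} (h : IsRegularAt p z₀ f u (u k)) :
    ‖zetaJump f u z₀ (u k)‖ₑ ^ p ≤ jumpBound p z₀ f u k := by
  have h1 : Tendsto (fun n => ‖backIter f u (u k) n z₀ - backIterLeft f u (u k) n z₀‖ₑ ^ p) atTop
      (𝓝 (‖zetaJump f u z₀ (u k)‖ₑ ^ p)) :=
    ((h.tendsto_zetaJump hp0 hp1).enorm).ennrpow_const p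
  refine le_of_tendsto h1 ?_
  filter_upwards [eventually_ge_atTop (k + 1)] with n hn
  obtain ⟨m, rfl⟩ := Nat.exists_eq_add_of_le hn
  rw [backIter_eq_backComp, backIterLeft]
  refine (enorm_backComp_sub_backComp_rpow_le hp0 hp1 (enorm_thin_sub_rpow_le hp0 _ f)
    (k := k) ?_ ?_ m z₀).trans_eq ?_
  · intro j hj
    have : u j ≠ u k := fun h => hj (hu h)
    unfold thin
    simp only [Set.mem_ofPred_eq, lt_iff_le_and_ne, this, ne_eq, not_false_eq_true, and_true]
  · simp [thin]
  · simp only [thinModulus_eq_sieveModulus, enorm_thin_sub_self_rpow hp0, jumpBound]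
    simp [sieveDisplacement, sieveModulus]

end pathwise

/-! ### Measurability -/

namespace LipFun

theorem dist_eq (f g : LipFun) : dist f g = |f 0 - g 0| + lipConst (f.toFun - g.toFun) := rfl

theorem continuous_L : Continuous L := by
  refine LipschitzWith.continuous (K := 1) (LipschitzWith.of_dist_le_mul fun f g => ?_)
  have key : ∀ f g : LipFun, f.L - g.L ≤ dist f g := fun f g => by
    have h := lipConst_add_le (lipschitz_sub f g) g.lipschitz
    rw [sub_add_cancel] at h
    rw [dist_eq]
    change lipConst f.toFun - lipConst g.toFun ≤ _
    linarith [abs_nonneg (f 0 - g 0)]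
  rw [NNReal.coe_one, one_mul, Real.dist_eq, abs_le]
  have h := key g f
  rw [dist_comm] at h
  exact ⟨by linarith, key f g⟩

theorem continuous_eval (z : ℝ) : Continuous fun f : LipFun => f z := by
  refine LipschitzWith.continuous (K := 1 + ‖z‖₊) (LipschitzWith.of_dist_le_mul fun f g => ?_)
  have h := abs_sub_le_lipConst (lipschitz_sub f g) 0 z
  have h1 := lipConst_nonneg (f.toFun - g.toFun)
  have h2 := abs_sub_abs_le_abs_sub ((f.toFun - g.toFun) z) ((f.toFun - g.toFun) 0)
  simp only [Pi.sub_apply, zero_sub, abs_neg] at h h2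
  rw [dist_eq, Real.dist_eq, NNReal.coe_add, NNReal.coe_one, coe_nnnorm, Real.norm_eq_abs]
  nlinarith [abs_nonneg z, abs_nonneg (f 0 - g 0)]

theorem continuous (f : LipFun) : Continuous f.toFun := by
  obtain ⟨K, hK⟩ := f.lipschitz
  exact hK.continuous

/-- A Carathéodory function: continuous in the point, measurable in `f`. Separability is needed of
the line only, not of the Lipschitz space. -/
theorem measurable_eval : Measurable fun q : LipFun × ℝ => q.1 q.2 := by
  have h := measurable_uncurry_of_continuous_of_measurable (u := fun (z : ℝ) (f : LipFun) => f z)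
    (fun f => f.continuous) (fun z => (continuous_eval z).measurable)
  exact h.comp measurable_swap

theorem measurable_modulus (p : ℝ) : Measurable (modulus p) :=
  continuous_L.measurable.ennreal_ofReal.pow_const p

theorem measurable_displacement (p z : ℝ) : Measurable (displacement p z) :=
  ((continuous_eval z).measurable.sub_const z).enorm.pow_const p

end LipFun

theorem measurable_sieveModulus (p : ℝ) :
    Measurable (Function.uncurry (sieveModulus p)) := by
  refine Measurable.ite (measurableSet_le (by fun_prop) (by fun_prop)) ?_ measurable_const
  exact (measurable_modulus p).comp (by fun_prop)

theorem measurable_sieveDisplacement (p z : ℝ) :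
    Measurable (Function.uncurry (sieveDisplacement p z)) := by
  refine Measurable.ite (measurableSet_le (by fun_prop) (by fun_prop)) ?_ measurable_const
  exact (measurable_displacement p z).comp (by fun_prop)

theorem measurable_maxModulus (p c d : ℝ) : Measurable (maxModulus p c d) := by
  have h : Measurable fun y : LipFun × ℝ => modulus p y.1 := (measurable_modulus p).comp measurable_fst
  exact Measurable.ite (measurableSet_le (by fun_prop) (by fun_prop)) h
    (Measurable.ite (measurableSet_le (by fun_prop) (by fun_prop)) (h.max measurable_const)
      measurable_const)

section measurability

variable {Ω : Type*} [MeasurableSpace Ω] {F : ℕ → Ω → LipFun} {U : ℕ → Ω → ℝ}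

theorem measurable_backComp {g : ℕ → Ω → ℝ → ℝ}
    (hg : ∀ k, Measurable (Function.uncurry (g k))) (n : ℕ) :
    ∀ {z : Ω → ℝ}, Measurable z → Measurable fun ω => backComp (fun k => g k ω) n (z ω) := by
  induction n with
  | zero => exact fun hz => hz
  | succ n ih => exact fun hz => ih ((hg n).comp (measurable_id.prodMk hz))

open Classical in
theorem measurable_backComp_thin (hF : ∀ k, Measurable (F k)) {s : Ω → Set ℕ}
    (hs : ∀ k, MeasurableSet {ω | k ∈ s ω}) (n : ℕ) (z : ℝ) :
    Measurable fun ω => backComp (thin (s ω) (fun k => F k ω)) n z := by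
  refine measurable_backComp (g := fun k ω => thin (s ω) (fun k => F k ω) k) (fun k => ?_) n
    measurable_const
  have h : Function.uncurry (fun ω => thin (s ω) (fun k => F k ω) k) =
      fun q : Ω × ℝ => if q.1 ∈ {ω | k ∈ s ω} then F k q.1 q.2 else q.2 := by
    ext q
    simp only [Function.uncurry, thin, Set.mem_ofPred_eq]
    split_ifs <;> rfl
  rw [h]
  refine Measurable.ite (measurable_fst (hs k)) ?_ measurable_snd
  exact measurable_eval.comp (((hF k).comp measurable_fst).prodMk measurable_snd)

theorem measurable_backIter (hF : ∀ k, Measurable (F k)) (hU : ∀ k, Measurable (U k)) {x : Ω → ℝ}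
    (hx : Measurable x) (n : ℕ) (z : ℝ) :
    Measurable fun ω => backIter (fun k => F k ω) (fun k => U k ω) (x ω) n z := by
  simp only [backIter_eq_backComp]
  exact measurable_backComp_thin hF (fun k => measurableSet_le (hU k) hx) n z

theorem measurable_backIterLeft (hF : ∀ k, Measurable (F k)) (hU : ∀ k, Measurable (U k))
    {x : Ω → ℝ} (hx : Measurable x) (n : ℕ) (z : ℝ) :
    Measurable fun ω => backIterLeft (fun k => F k ω) (fun k => U k ω) (x ω) n z :=
  measurable_backComp_thin hF (fun k => measurableSet_lt (hU k) hx) n z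

end measurability

/-! ### Expectations of products -/

/-- The expectation of a product in which the factors depend on independent variables and on one
further independent variable. -/
theorem lintegral_mul_prod_eq_of_iIndepFun {Ω E : Type*} [MeasurableSpace Ω] [MeasurableSpace E]
    {P : Measure Ω} [IsProbabilityMeasure P] {μ : Measure E} {X : ℕ → Ω → E}
    (hX : ∀ k, Measurable (X k)) (hlaw : ∀ k, P.map (X k) = μ) (hindep : iIndepFun X P)
    {k : ℕ} {s : Finset ℕ} (hk : k ∉ s) {φ : E → ℝ≥0∞} (hφ : Measurable φ) {ψ : ℕ → E → E → ℝ≥0∞}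
    (hψ : ∀ j, Measurable (Function.uncurry (ψ j))) :
    ∫⁻ ω, φ (X k ω) * ∏ j ∈ s, ψ j (X k ω) (X j ω) ∂P =
      ∫⁻ y, φ y * ∏ j ∈ s, ∫⁻ z, ψ j y z ∂μ ∂μ := by
  have : IsProbabilityMeasure μ := hlaw k ▸ Measure.isProbabilityMeasure_map (hX k).aemeasurable
  have hψ' : ∀ j y, Measurable (ψ j y) := fun j y => (hψ j).comp measurable_prodMk_left
  let Y : Ω → (s → E) := fun ω j => X j ω
  have hY : Measurable Y := measurable_pi_lambda _ fun j => hX j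
  have h1 : IndepFun (X k) Y P :=
    (hindep.indepFun_finset {k} s (Finset.disjoint_singleton_left.2 hk) hX).comp
      (φ := fun y : (({k} : Finset ℕ) → E) => y ⟨k, Finset.mem_singleton_self k⟩) (ψ := id)
      (measurable_pi_apply _) measurable_id
  -- The joint law is a product, so Fubini permits freezing `X k = y`; the remaining factors are
  -- then independent.
  have h2 := (indepFun_iff_map_prod_eq_prod_map_map (hX k).aemeasurable hY.aemeasurable).1 h1
  let G : E × (s → E) → ℝ≥0∞ := fun q => φ q.1 * ∏ j : s, ψ j q.1 (q.2 j)
  have hG : Measurable G := by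
    refine (hφ.comp measurable_fst).mul (Finset.measurable_prod _ fun j _ => ?_)
    exact (hψ j).comp (measurable_fst.prodMk ((measurable_pi_apply j).comp measurable_snd))
  have h3 : ∫⁻ ω, φ (X k ω) * ∏ j ∈ s, ψ j (X k ω) (X j ω) ∂P = ∫⁻ ω, G (X k ω, Y ω) ∂P := by
    refine lintegral_congr fun ω => ?_
    simp only [G, Y]
    rw [Finset.prod_coe_sort s fun j => ψ j (X k ω) (X j ω)]
  have : IsProbabilityMeasure (P.map Y) := Measure.isProbabilityMeasure_map hY.aemeasurable
  rw [h3, ← lintegral_map hG ((hX k).prodMk hY), h2, lintegral_prod _ hG.aemeasurable, hlaw k]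
  refine lintegral_congr fun y => ?_
  have hGy : Measurable fun z => G (y, z) := hG.comp measurable_prodMk_left
  rw [lintegral_map hGy hY]
  simp only [G, Y]
  have h4 : Measurable fun ω => ∏ j ∈ s, ψ j y (X j ω) :=
    Finset.measurable_prod _ fun j _ => (hψ' j y).comp (hX j)
  simp_rw [fun ω => Finset.prod_coe_sort s fun j => ψ j y (X j ω)]
  rw [lintegral_const_mul _ h4, lintegral_prod_eq_prod_lintegral_of_indepFun s (fun j ω => ψ j y (X j ω))
    (hindep.comp (fun j => ψ j y) fun j => hψ' j y) fun j => (hψ' j y).comp (hX j)]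
  congr 1
  refine Finset.prod_congr rfl fun j _ => ?_
  rw [← hlaw j, lintegral_map (hψ' j y) (hX j)]

/-- The uniform distribution on `[0, 1]`. -/
noncomputable abbrev unitUniform : Measure ℝ := volume.restrict (Set.Icc (0 : ℝ) 1)

instance : IsProbabilityMeasure unitUniform := ⟨by simp⟩

theorem unitUniform_Iic {x : ℝ} (hx : x ∈ Set.Icc (0 : ℝ) 1) :
    unitUniform (Set.Iic x) = ENNReal.ofReal x := by
  rw [Measure.restrict_apply measurableSet_Iic]
  have : Set.Iic x ∩ Set.Icc 0 1 = Set.Icc 0 x := by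
    ext y
    exact ⟨fun h => ⟨h.2.1, h.1⟩, fun h => ⟨h.2, h.1, h.2.trans hx.2⟩⟩
  rw [this, Real.volume_Icc, sub_zero]

theorem unitUniform_Ioi {x : ℝ} (hx : x ∈ Set.Icc (0 : ℝ) 1) :
    unitUniform (Set.Ioi x) = ENNReal.ofReal (1 - x) := by
  rw [Measure.restrict_apply measurableSet_Ioi]
  have : Set.Ioi x ∩ Set.Icc 0 1 = Set.Ioc x 1 := by
    ext y
    exact ⟨fun h => ⟨h.1, h.2.2⟩, fun h => ⟨h.1, hx.1.trans h.1.le, h.2⟩⟩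
  rw [this, Real.volume_Ioc]

/-! ### One-step means under the product of `ν` and the uniform law. -/

section moments

variable (p z₀ : ℝ) (ν : Measure LipFun)

/-- The moment `E L_f ^ p`. -/
noncomputable def meanModulus : ℝ≥0∞ := ∫⁻ f, modulus p f ∂ν

/-- The moment `E |f z₀ - z₀| ^ p`. -/
noncomputable def meanDisplacement : ℝ≥0∞ := ∫⁻ f, displacement p z₀ f ∂ν

theorem lintegral_sieveDisplacement {x : ℝ} (hx : x ∈ Set.Icc (0 : ℝ) 1) :
    ∫⁻ y, sieveDisplacement p z₀ x y ∂(ν.prod unitUniform) =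
      meanDisplacement p z₀ ν * ENNReal.ofReal x := by
  have h1 : Measurable ((Set.Iic x).indicator (1 : ℝ → ℝ≥0∞)) :=
    measurable_one.indicator measurableSet_Iic
  rw [← unitUniform_Iic hx, ← lintegral_indicator_one measurableSet_Iic, meanDisplacement,
    ← lintegral_prod_mul (measurable_displacement p z₀).aemeasurable h1.aemeasurable]
  refine lintegral_congr fun y => ?_
  by_cases h : y.2 ≤ x <;> simp [sieveDisplacement, h]

variable [IsProbabilityMeasure ν]

/-- Serves both moduli: with `c = d = x` the integrand is `sieveModulus`, and for `c ≤ d` it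
dominates `maxModulus`, because both indicators are 1 on `(c, d]` and a maximum is at most the sum.
-/
theorem lintegral_indicator_add_indicator (c d : ℝ) (hc : c ∈ Set.Icc (0 : ℝ) 1)
    (hd : d ∈ Set.Icc (0 : ℝ) 1) :
    ∫⁻ y, (modulus p y.1 * (Set.Iic d).indicator 1 y.2 + 1 * (Set.Ioi c).indicator 1 y.2)
      ∂(ν.prod unitUniform) = meanModulus p ν * ENNReal.ofReal d + ENNReal.ofReal (1 - c) := by
  have h1 : Measurable ((Set.Iic d).indicator (1 : ℝ → ℝ≥0∞)) :=
    measurable_one.indicator measurableSet_Iic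
  have h2 : Measurable ((Set.Ioi c).indicator (1 : ℝ → ℝ≥0∞)) :=
    measurable_one.indicator measurableSet_Ioi
  have h3 : Measurable fun y : LipFun × ℝ => modulus p y.1 * (Set.Iic d).indicator 1 y.2 :=
    ((measurable_modulus p).comp measurable_fst).mul (h1.comp measurable_snd)
  rw [lintegral_add_left h3,
    lintegral_prod_mul (measurable_modulus p).aemeasurable h1.aemeasurable,
    lintegral_prod_mul aemeasurable_const h2.aemeasurable, lintegral_indicator_one measurableSet_Iic,
    lintegral_indicator_one measurableSet_Ioi, unitUniform_Iic hd, unitUniform_Ioi hc]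
  simp [meanModulus]

theorem lintegral_sieveModulus {x : ℝ} (hx : x ∈ Set.Icc (0 : ℝ) 1) :
    ∫⁻ y, sieveModulus p x y ∂(ν.prod unitUniform) =
      meanModulus p ν * ENNReal.ofReal x + ENNReal.ofReal (1 - x) := by
  rw [← lintegral_indicator_add_indicator p ν x x hx hx]
  refine lintegral_congr fun y => ?_
  by_cases h : y.2 ≤ x
  · simp [sieveModulus, h]
  · simp [sieveModulus, h, not_le.1 h]

theorem lintegral_maxModulus_le {c d : ℝ} (hc : c ∈ Set.Icc (0 : ℝ) 1)
    (hd : d ∈ Set.Icc (0 : ℝ) 1) (hcd : c ≤ d) :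
    ∫⁻ y, maxModulus p c d y ∂(ν.prod unitUniform) ≤
      meanModulus p ν * ENNReal.ofReal d + ENNReal.ofReal (1 - c) := by
  rw [← lintegral_indicator_add_indicator p ν c d hc hd]
  refine lintegral_mono fun y => ?_
  by_cases h : y.2 ≤ c
  · simp [maxModulus, h, h.trans hcd]
  · by_cases h' : y.2 ≤ d
    · simp [maxModulus, h, h', not_le.1 h]
    · simp [maxModulus, h, h', not_le.1 h]

variable {p ν}

/-- By truncation both sides are 0 when `c ≤ φ * d`; the geometric series is controlled when `c > φ
* d`. -/
theorem one_sub_mul_add_le {φ : ℝ} (hφ0 : 0 ≤ φ) {c d : ℝ} (hd0 : 0 ≤ d) (hc1 : c ≤ 1) :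
    1 - (ENNReal.ofReal φ * ENNReal.ofReal d + ENNReal.ofReal (1 - c)) =
      ENNReal.ofReal (c - φ * d) := by
  rw [← ENNReal.ofReal_mul hφ0, ← ENNReal.ofReal_add (by positivity) (by linarith),
    ← ENNReal.ofReal_one, ← ENNReal.ofReal_sub _ (by nlinarith)]
  congr 1
  ring

/-- The ratio is `1 - x (1 - Φ)`. The resulting `1 / x` is the source of the weight `dt / t` in the
condition on `h`. -/
theorem tsum_lintegral_sieveModulus_pow (h1 : meanModulus p ν < 1) {x : ℝ}
    (hx : x ∈ Set.Ioc (0 : ℝ) 1) :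
    ∑' n : ℕ, (∫⁻ y, sieveModulus p x y ∂(ν.prod unitUniform)) ^ n =
      (ENNReal.ofReal x)⁻¹ * (1 - meanModulus p ν)⁻¹ := by
  obtain ⟨φ, hφ0, hφ⟩ : ∃ φ : ℝ, 0 ≤ φ ∧ meanModulus p ν = ENNReal.ofReal φ :=
    ⟨_, ENNReal.toReal_nonneg, (ENNReal.ofReal_toReal h1.ne_top).symm⟩
  rw [ENNReal.tsum_geometric, lintegral_sieveModulus p ν ⟨hx.1.le, hx.2⟩, hφ,
    one_sub_mul_add_le hφ0 hx.1.le hx.2, ← ENNReal.ofReal_one, ← ENNReal.ofReal_sub _ hφ0,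
    ← ENNReal.mul_inv (Or.inr ENNReal.ofReal_ne_top) (Or.inl ENNReal.ofReal_ne_top),
    ← ENNReal.ofReal_mul hx.1.le]
  congr 2
  ring

/-- The mean displacement carries a factor `x` that cancels the `1 / x`, so the value does not
depend on `x`. -/
theorem tsum_lintegral_sieveModulus_pow_mul (h1 : meanModulus p ν < 1) {x : ℝ}
    (hx : x ∈ Set.Ioc (0 : ℝ) 1) :
    ∑' n : ℕ, (∫⁻ y, sieveModulus p x y ∂(ν.prod unitUniform)) ^ n *
      ∫⁻ y, sieveDisplacement p z₀ x y ∂(ν.prod unitUniform) =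
      meanDisplacement p z₀ ν * (1 - meanModulus p ν)⁻¹ := by
  rw [ENNReal.tsum_mul_right, tsum_lintegral_sieveModulus_pow h1 hx,
    lintegral_sieveDisplacement p z₀ ν ⟨hx.1.le, hx.2⟩]
  calc (ENNReal.ofReal x)⁻¹ * (1 - meanModulus p ν)⁻¹ *
        (meanDisplacement p z₀ ν * ENNReal.ofReal x)
      = (ENNReal.ofReal x)⁻¹ * ENNReal.ofReal x *
        (meanDisplacement p z₀ ν * (1 - meanModulus p ν)⁻¹) := by ring
    _ = _ := by
      rw [ENNReal.inv_mul_cancel (by simpa using hx.1) ENNReal.ofReal_ne_top, one_mul]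

theorem meanModulus_lt_one (hp0 : 0 < p) (hp1 : p ≤ 1) (hL : Integrable (fun f : LipFun => f.L) ν)
    (hΦ : ∫ f : LipFun, f.L ^ p ∂ν < 1) : meanModulus p ν < 1 := by
  -- Without integrability the Bochner integral in `hΦ` would be 0 by default and say nothing; `t ^
  -- p ≤ 1 + t` supplies it.
  have hi : Integrable (fun f : LipFun => f.L ^ p) ν := by
    refine ((integrable_const (1 : ℝ)).add hL).mono'
      (continuous_L.measurable.pow_const p).aestronglyMeasurable (Eventually.of_forall fun f => ?_)
    have h0 := f.L_nonneg
    rw [Real.norm_of_nonneg (by positivity), Pi.add_apply]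
    rcases le_total f.L 1 with h | h
    · linarith [Real.rpow_le_one h0 h hp0.le]
    · have := Real.rpow_le_rpow_of_exponent_le h hp1
      rw [Real.rpow_one] at this
      linarith
  have h : meanModulus p ν = ENNReal.ofReal (∫ f : LipFun, f.L ^ p ∂ν) := by
    rw [ofReal_integral_eq_lintegral_ofReal hi
      (Eventually.of_forall fun f => Real.rpow_nonneg f.L_nonneg p)]
    exact lintegral_congr fun f => ENNReal.ofReal_rpow_of_nonneg f.L_nonneg hp0.le
  rw [h, ← ENNReal.ofReal_one]
  exact (ENNReal.ofReal_lt_ofReal_iff zero_lt_one).2 hΦ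

/-- The base point is moved from `z` to `z₀` through the Lipschitz bound, and `t ^ p ≤ 1 + t`
reduces to the first moment at `z`. -/
theorem meanDisplacement_ne_top (hp0 : 0 < p) (hp1 : p ≤ 1) (h1 : meanModulus p ν < 1)
    (hz : ∃ z : ℝ, Integrable (fun f : LipFun => f z - z) ν) : meanDisplacement p z₀ ν ≠ ∞ := by
  obtain ⟨z, hz⟩ := hz
  have hle : ∀ f : LipFun, displacement p z₀ f ≤
      modulus p f * ‖z₀ - z‖ₑ ^ p + ((1 + ‖f z - z‖ₑ) + ‖z - z₀‖ₑ ^ p) := fun f => by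
    refine (enorm_sub_rpow_triangle (f z₀) (f z) z₀ hp0 hp1).trans ?_
    refine add_le_add (enorm_sub_rpow_le hp0 f z₀ z) ?_
    refine (enorm_sub_rpow_triangle (f z) z z₀ hp0 hp1).trans ?_
    gcongr
    rcases le_total ‖f z - z‖ₑ 1 with h | h
    · exact (ENNReal.rpow_le_one h hp0.le).trans le_self_add
    · calc _ ≤ ‖f z - z‖ₑ ^ (1 : ℝ) := ENNReal.rpow_le_rpow_of_exponent_le h hp1
        _ ≤ _ := by rw [ENNReal.rpow_one]; exact le_add_self
  refine ne_top_of_le_ne_top ?_ (lintegral_mono hle)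
  have hm : Measurable fun f : LipFun => ‖f z - z‖ₑ :=
    ((continuous_eval z).measurable.sub_const z).enorm
  rw [lintegral_add_left ((measurable_modulus p).mul_const _),
    lintegral_add_left (hm.const_add 1), lintegral_add_left measurable_const,
    lintegral_mul_const _ (measurable_modulus p)]
  have hr : ∀ y : ℝ, ‖y‖ₑ ^ p ≠ ∞ := fun y => ENNReal.rpow_ne_top_of_nonneg hp0.le enorm_ne_top
  have hf : ∫⁻ f : LipFun, ‖f z - z‖ₑ ∂ν ≠ ∞ := hz.2.ne
  simp only [lintegral_const, measure_univ, mul_one]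
  exact ENNReal.add_ne_top.2 ⟨ENNReal.mul_ne_top h1.ne_top (hr _),
    ENNReal.add_ne_top.2 ⟨ENNReal.add_ne_top.2 ⟨ENNReal.one_ne_top, hf⟩, hr _⟩⟩

end moments

/-! ### Almost sure regularity and moments of the jumps. -/

section iid

variable {ν : Measure LipFun} {Ω : Type*} [MeasurableSpace Ω] {P : Measure Ω}
  {F : ℕ → Ω → LipFun} {U : ℕ → Ω → ℝ} {p : ℝ}

theorem ae_mem_Ioc_of_map_eq [IsProbabilityMeasure ν] (hF : ∀ k, Measurable (F k)) (hU : ∀ k, Measurable (U k))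
    (hlaw : ∀ k, P.map (fun ω => (F k ω, U k ω)) = ν.prod unitUniform) :
    ∀ᵐ ω ∂P, ∀ k, U k ω ∈ Set.Ioc (0 : ℝ) 1 := by
  refine ae_all_iff.2 fun k => ?_
  have h1 : ∀ᵐ x ∂unitUniform, x ∈ Set.Ioc (0 : ℝ) 1 := by
    rw [unitUniform, ← restrict_Ioc_eq_restrict_Icc]
    exact ae_restrict_mem measurableSet_Ioc
  have h2 : P.map (U k) = unitUniform := by
    have := congrArg (Measure.map Prod.snd) (hlaw k)
    rwa [Measure.map_map measurable_snd ((hF k).prodMk (hU k)), Measure.map_snd_prod, measure_univ,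
      one_smul] at this
  rw [← h2] at h1
  exact ae_of_ae_map (hU k).aemeasurable h1

/-- The uniform law has no atoms: given `U i = x`, the event `U j = x` is null. -/
theorem ae_injective_of_iIndepFun [IsProbabilityMeasure P] (hF : ∀ k, Measurable (F k)) (hU : ∀ k, Measurable (U k))
    (hlaw : ∀ k, P.map (fun ω => (F k ω, U k ω)) = ν.prod unitUniform)
    (hindep : iIndepFun (fun k ω => (F k ω, U k ω)) P) :
    ∀ᵐ ω ∂P, Function.Injective fun k => U k ω := by
  have h : ∀ i j, i ≠ j → ∀ᵐ ω ∂P, U i ω ≠ U j ω := fun i j hij => by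
    have hm : Measurable (Function.uncurry fun x y : LipFun × ℝ =>
        ({x.2} : Set ℝ).indicator (1 : ℝ → ℝ≥0∞) y.2) := by
      have : (Function.uncurry fun x y : LipFun × ℝ =>
          ({x.2} : Set ℝ).indicator (1 : ℝ → ℝ≥0∞) y.2) =
          {q : (LipFun × ℝ) × (LipFun × ℝ) | q.2.2 = q.1.2}.indicator 1 := by
        ext q
        by_cases hq : q.2.2 = q.1.2 <;> simp [Function.uncurry, hq]
      rw [this]
      exact measurable_one.indicator (measurableSet_eq_fun (by fun_prop) (by fun_prop))
    have h1 := lintegral_mul_prod_eq_of_iIndepFun (X := fun k ω => (F k ω, U k ω))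
      (fun k => (hF k).prodMk (hU k)) hlaw hindep (k := i) (s := {j}) (by simpa using hij)
      measurable_one (ψ := fun _ x y => ({x.2} : Set ℝ).indicator (1 : ℝ → ℝ≥0∞) y.2)
      (fun _ => hm)
    have h2 : ∀ x : ℝ, ∫⁻ y : LipFun × ℝ, ({x} : Set ℝ).indicator (1 : ℝ → ℝ≥0∞) y.2
        ∂(ν.prod unitUniform) = 0 := fun x => by
      have h3 := lintegral_prod_mul (μ := ν) (ν := unitUniform) (f := fun _ => 1)
        (g := ({x} : Set ℝ).indicator (1 : ℝ → ℝ≥0∞)) aemeasurable_const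
        (measurable_one.indicator (measurableSet_singleton x)).aemeasurable
      rw [lintegral_indicator_one (measurableSet_singleton x), measure_singleton, mul_zero] at h3
      simpa only [one_mul] using h3
    simp only [Pi.one_apply, Finset.prod_singleton, one_mul, h2, lintegral_zero] at h1
    have hm' : Measurable fun ω => ({U i ω} : Set ℝ).indicator (1 : ℝ → ℝ≥0∞) (U j ω) :=
      hm.comp (((hF i).prodMk (hU i)).prodMk ((hF j).prodMk (hU j)))
    rw [lintegral_eq_zero_iff hm'] at h1
    filter_upwards [h1] with ω hω heq
    simp [heq] at hω
  have h' : ∀ᵐ ω ∂P, ∀ i j, i ≠ j → U i ω ≠ U j ω :=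
    ae_all_iff.2 fun i => ae_all_iff.2 fun j => by
      by_cases hij : i = j
      · exact Eventually.of_forall fun ω h => absurd hij h
      · filter_upwards [h i j hij] with ω hω _ using hω
  filter_upwards [h'] with ω hω i j hij
  by_contra hne
  exact hω i j hne hij

/-- The constant in the bound for the moments of the jumps. -/
noncomputable def jumpConst (p z₀ : ℝ) (ν : Measure LipFun) : ℝ≥0∞ :=
  meanDisplacement p z₀ ν + (meanModulus p ν + 1) *
    (meanDisplacement p z₀ ν * (1 - meanModulus p ν)⁻¹)

theorem jumpConst_ne_top {z₀ : ℝ} (h1 : meanModulus p ν < 1)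
    (h2 : meanDisplacement p z₀ ν ≠ ∞) : jumpConst p z₀ ν ≠ ∞ := by
  have h3 : (1 - meanModulus p ν)⁻¹ ≠ ∞ := ENNReal.inv_ne_top.2 (tsub_pos_of_lt h1).ne'
  exact ENNReal.add_ne_top.2 ⟨h2, ENNReal.mul_ne_top
    (ENNReal.add_ne_top.2 ⟨h1.ne_top, ENNReal.one_ne_top⟩) (ENNReal.mul_ne_top h2 h3)⟩

theorem measurable_jumpBound (hF : ∀ k, Measurable (F k)) (hU : ∀ k, Measurable (U k)) (z₀ : ℝ)
    (k : ℕ) : Measurable fun ω => jumpBound p z₀ (fun k => F k ω) (fun k => U k ω) k := by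
  have hα : ∀ j, Measurable fun ω => sieveModulus p (U k ω) (F j ω, U j ω) := fun j =>
    (measurable_sieveModulus p).comp ((hU k).prodMk ((hF j).prodMk (hU j)))
  have hδ : ∀ j, Measurable fun ω => sieveDisplacement p z₀ (U k ω) (F j ω, U j ω) := fun j =>
    (measurable_sieveDisplacement p z₀).comp ((hU k).prodMk ((hF j).prodMk (hU j)))
  refine (Finset.measurable_prod _ fun j _ => hα j).mul
    (((measurable_displacement p z₀).comp (hF k)).add
      ((((measurable_modulus p).comp (hF k)).add_const 1).mul (Measurable.tsum fun i => ?_)))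
  exact (Finset.measurable_prod _ fun j _ => hα _).mul (hδ _)

variable [IsProbabilityMeasure ν] [IsProbabilityMeasure P]

/-- With `Φ < q < 1`, the intervals `(q ^ (n + 1), q ^ n]` cover `(0, 1]`. On each the dominating
series has finite expectation, being bounded by a convergent geometric series; countability gives
one null set for all `x`. -/
theorem ae_isRegularAt (hp0 : 0 < p) (hp1 : p ≤ 1) (h1 : meanModulus p ν < 1)
    (hz : ∃ z : ℝ, Integrable (fun f : LipFun => f z - z) ν)
    (hF : ∀ k, Measurable (F k)) (hU : ∀ k, Measurable (U k))
    (hlaw : ∀ k, P.map (fun ω => (F k ω, U k ω)) = ν.prod unitUniform)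
    (hindep : iIndepFun (fun k ω => (F k ω, U k ω)) P) (z₀ : ℝ) :
    ∀ᵐ ω ∂P, ∀ x ∈ Set.Ioc (0 : ℝ) 1,
      IsRegularAt p z₀ (fun k => F k ω) (fun k => U k ω) x := by
  obtain ⟨φ, hφ0, hφ⟩ : ∃ φ : ℝ, 0 ≤ φ ∧ meanModulus p ν = ENNReal.ofReal φ :=
    ⟨_, ENNReal.toReal_nonneg, (ENNReal.ofReal_toReal h1.ne_top).symm⟩
  have hφ1 : φ < 1 := by
    rw [hφ, ← ENNReal.ofReal_one] at h1
    exact (ENNReal.ofReal_lt_ofReal_iff zero_lt_one).1 h1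
  obtain ⟨q, hq, hq1⟩ := exists_between hφ1
  have hq0 : 0 < q := hφ0.trans_lt hq
  have hδ : Measurable fun y : LipFun × ℝ => displacement p z₀ y.1 :=
    (measurable_displacement p z₀).comp measurable_fst
  have key : ∀ n : ℕ, ∀ᵐ ω ∂P,
      ∑' k, domSeries p z₀ (q ^ (n + 1)) (q ^ n) (fun k => F k ω) (fun k => U k ω) k ≠ ∞ := by
    intro n
    have hc : q ^ (n + 1) ∈ Set.Icc (0 : ℝ) 1 := ⟨by positivity, pow_le_one₀ hq0.le hq1.le⟩
    have hd : q ^ n ∈ Set.Icc (0 : ℝ) 1 := ⟨by positivity, pow_le_one₀ hq0.le hq1.le⟩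
    have hm : ∀ k, Measurable fun ω => domSeries p z₀ (q ^ (n + 1)) (q ^ n) (fun k => F k ω)
        (fun k => U k ω) k := fun k =>
      (Finset.measurable_prod _ fun j _ =>
        (measurable_maxModulus p _ _).comp ((hF j).prodMk (hU j))).mul
        ((measurable_displacement p z₀).comp (hF k))
    suffices hfin : ∫⁻ ω, ∑' k, domSeries p z₀ (q ^ (n + 1)) (q ^ n) (fun k => F k ω)
        (fun k => U k ω) k ∂P ≠ ∞ by
      filter_upwards [ae_lt_top (Measurable.tsum hm) hfin] with ω hω using hω.ne
    rw [lintegral_tsum fun k => (hm k).aemeasurable]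
    set ρ := ∫⁻ y, maxModulus p (q ^ (n + 1)) (q ^ n) y ∂(ν.prod unitUniform) with hρ
    have hint : ∀ k, ∫⁻ ω, domSeries p z₀ (q ^ (n + 1)) (q ^ n) (fun k => F k ω)
        (fun k => U k ω) k ∂P = ρ ^ k * meanDisplacement p z₀ ν := fun k => by
      have := lintegral_mul_prod_eq_of_iIndepFun (X := fun k ω => (F k ω, U k ω))
        (fun k => (hF k).prodMk (hU k)) hlaw hindep (k := k) (s := Finset.range k) (by simp)
        hδ
        (ψ := fun _ _ y => maxModulus p (q ^ (n + 1)) (q ^ n) y)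
        (fun _ => (measurable_maxModulus p _ _).comp measurable_snd)
      simp only [Finset.prod_const, Finset.card_range, ← hρ] at this
      rw [lintegral_mul_const _ hδ] at this
      rw [mul_comm, meanDisplacement]
      have h2 := lintegral_prod_mul (μ := ν) (ν := unitUniform) (g := fun _ => 1)
        (measurable_displacement p z₀).aemeasurable aemeasurable_const
      simp only [mul_one, lintegral_const, measure_univ] at h2
      rw [← h2, ← this]
      exact lintegral_congr fun ω => mul_comm _ _
    simp only [hint]
    rw [ENNReal.tsum_mul_right, ENNReal.tsum_geometric]
    refine ENNReal.mul_ne_top ?_ (meanDisplacement_ne_top z₀ hp0 hp1 h1 hz)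
    have hle := lintegral_maxModulus_le p ν hc hd (pow_le_pow_of_le_one hq0.le hq1.le n.le_succ)
    rw [← hρ, hφ] at hle
    have h3 := tsub_le_tsub_left hle 1
    rw [one_sub_mul_add_le hφ0 hd.1 hc.2] at h3
    -- The difference is `q ^ n * (q - φ)`, whence the choice `q > φ`.
    have h4 : 0 < q ^ (n + 1) - φ * q ^ n := by
      rw [pow_succ]
      nlinarith [pow_pos hq0 n]
    exact ENNReal.inv_ne_top.2 ((ENNReal.ofReal_pos.2 h4).trans_le h3).ne'
  filter_upwards [ae_all_iff.2 key] with ω hω x hx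
  obtain ⟨n, hn, hn'⟩ := exists_nat_pow_near_of_lt_one hx.1 hx.2 hq0 hq1
  exact ⟨_, _, hn, hn', hω n⟩

/-- The moments of order `p` of `ζ(x) - z₀` are bounded uniformly in `x`. -/
theorem lintegral_enorm_zeta_sub_rpow_le (hp0 : 0 < p) (hp1 : p ≤ 1) (h1 : meanModulus p ν < 1)
    (hF : ∀ k, Measurable (F k)) (hU : ∀ k, Measurable (U k))
    (hlaw : ∀ k, P.map (fun ω => (F k ω, U k ω)) = ν.prod unitUniform)
    (hindep : iIndepFun (fun k ω => (F k ω, U k ω)) P) {z₀ x : ℝ} (hx : x ∈ Set.Ioc (0 : ℝ) 1)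
    (hreg : ∀ᵐ ω ∂P, IsRegularAt p z₀ (fun k => F k ω) (fun k => U k ω) x) :
    ∫⁻ ω, ‖zeta (fun k => F k ω) (fun k => U k ω) z₀ x - z₀‖ₑ ^ p ∂P ≤
      meanDisplacement p z₀ ν * (1 - meanModulus p ν)⁻¹ := by
  have hα : Measurable (sieveModulus p x) :=
    (measurable_sieveModulus p).comp measurable_prodMk_left
  have hδ : Measurable (sieveDisplacement p z₀ x) :=
    (measurable_sieveDisplacement p z₀).comp measurable_prodMk_left
  refine (lintegral_mono_ae (hreg.mono fun ω h => h.enorm_zeta_sub_rpow_le hp0 hp1)).trans_eq ?_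
  have hm : ∀ n, Measurable fun ω => (∏ k ∈ Finset.range n, sieveModulus p x (F k ω, U k ω)) *
      sieveDisplacement p z₀ x (F n ω, U n ω) := fun n =>
    (Finset.measurable_prod _ fun j _ => hα.comp ((hF j).prodMk (hU j))).mul
      (hδ.comp ((hF n).prodMk (hU n)))
  rw [lintegral_tsum fun n => (hm n).aemeasurable, ← tsum_lintegral_sieveModulus_pow_mul z₀ h1 hx]
  refine tsum_congr fun n => ?_
  have := lintegral_mul_prod_eq_of_iIndepFun (X := fun k ω => (F k ω, U k ω))
    (fun k => (hF k).prodMk (hU k)) hlaw hindep (k := n) (s := Finset.range n) (by simp) hδ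
    (ψ := fun _ _ y => sieveModulus p x y) (fun _ => hα.comp measurable_snd)
  simp only [Finset.prod_const, Finset.card_range] at this
  rw [lintegral_mul_const _ hδ, mul_comm (∫⁻ _, _ ∂_)] at this
  rw [← this]
  exact lintegral_congr fun ω => mul_comm _ _

/-- Given `U k = x`, the `k` outer maps contribute `R x ^ k`, the map `f k` contributes its means,
and the inner series contributes a constant by the cancellation of `x`. That cancellation holds on
`(0, 1]` only, hence `hW0`. -/
theorem lintegral_mul_jumpBound (h1 : meanModulus p ν < 1)
    (hF : ∀ k, Measurable (F k)) (hU : ∀ k, Measurable (U k))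
    (hlaw : ∀ k, P.map (fun ω => (F k ω, U k ω)) = ν.prod unitUniform)
    (hindep : iIndepFun (fun k ω => (F k ω, U k ω)) P) (z₀ : ℝ) {W : ℝ → ℝ≥0∞} (hW : Measurable W)
    (hW0 : ∀ x ∉ Set.Ioc (0 : ℝ) 1, W x = 0) (k : ℕ) :
    ∫⁻ ω, W (U k ω) * jumpBound p z₀ (fun k => F k ω) (fun k => U k ω) k ∂P =
      jumpConst p z₀ ν * ∫⁻ x, W x * (∫⁻ y, sieveModulus p x y ∂(ν.prod unitUniform)) ^ k
        ∂unitUniform := by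
  set μ := ν.prod unitUniform with hμ
  set R : ℝ → ℝ≥0∞ := fun x => ∫⁻ y, sieveModulus p x y ∂μ with hR
  set Δ : ℝ → ℝ≥0∞ := fun x => ∫⁻ y, sieveDisplacement p z₀ x y ∂μ with hΔ
  have hRm : Measurable R := (measurable_sieveModulus p).lintegral_prod_right'
  have hΔm : Measurable Δ := (measurable_sieveDisplacement p z₀).lintegral_prod_right'
  have hψ : Measurable (Function.uncurry fun x y : LipFun × ℝ => sieveModulus p x.2 y) :=
    (measurable_sieveModulus p).comp (measurable_fst.snd.prodMk measurable_snd)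
  have hψ' : Measurable (Function.uncurry fun x y : LipFun × ℝ => sieveDisplacement p z₀ x.2 y) :=
    (measurable_sieveDisplacement p z₀).comp (measurable_fst.snd.prodMk measurable_snd)
  have hX : ∀ k, Measurable fun ω => (F k ω, U k ω) := fun k => (hF k).prodMk (hU k)
  have hα : ∀ j, Measurable fun ω => sieveModulus p (U k ω) (F j ω, U j ω) := fun j =>
    (measurable_sieveModulus p).comp ((hU k).prodMk ((hF j).prodMk (hU j)))
  have hδ : ∀ j, Measurable fun ω => sieveDisplacement p z₀ (U k ω) (F j ω, U j ω) := fun j =>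
    (measurable_sieveDisplacement p z₀).comp ((hU k).prodMk ((hF j).prodMk (hU j)))
  have hWU : Measurable fun ω => W (U k ω) := hW.comp (hU k)
  have hWR : Measurable fun x => W x * R x ^ k := hW.mul (hRm.pow_const k)
  have hfst : ∫⁻ ω, W (U k ω) * displacement p z₀ (F k ω) *
      ∏ j ∈ Finset.range k, sieveModulus p (U k ω) (F j ω, U j ω) ∂P =
      meanDisplacement p z₀ ν * ∫⁻ x, W x * R x ^ k ∂unitUniform := by
    have hφ : Measurable fun y : LipFun × ℝ => W y.2 * displacement p z₀ y.1 :=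
      (hW.comp measurable_snd).mul ((measurable_displacement p z₀).comp measurable_fst)
    rw [lintegral_mul_prod_eq_of_iIndepFun (X := fun k ω => (F k ω, U k ω)) hX hlaw hindep
      (s := Finset.range k) (by simp) hφ (ψ := fun _ x y => sieveModulus p x.2 y) (fun _ => hψ),
      meanDisplacement, ← lintegral_prod_mul (measurable_displacement p z₀).aemeasurable
        hWR.aemeasurable]
    refine lintegral_congr fun y => ?_
    simp only [Finset.prod_const, Finset.card_range, hR]
    ring
  have hWRΔ : ∀ i, Measurable fun x => W x * R x ^ k * (R x ^ i * Δ x) := fun i =>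
    hWR.mul ((hRm.pow_const i).mul hΔm)
  have hsnd : ∀ i, ∫⁻ ω, W (U k ω) * (modulus p (F k ω) + 1) *
      ((∏ j ∈ Finset.range k, sieveModulus p (U k ω) (F j ω, U j ω)) *
      ((∏ j ∈ Finset.range i, sieveModulus p (U k ω) (F (k + 1 + j) ω, U (k + 1 + j) ω)) *
        sieveDisplacement p z₀ (U k ω) (F (k + 1 + i) ω, U (k + 1 + i) ω))) ∂P =
      (meanModulus p ν + 1) * ∫⁻ x, W x * R x ^ k * (R x ^ i * Δ x) ∂unitUniform := fun i => by
    have hφ : Measurable fun y : LipFun × ℝ => W y.2 * (modulus p y.1 + 1) :=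
      (hW.comp measurable_snd).mul (((measurable_modulus p).comp measurable_fst).add_const 1)
    -- The integrand is coded as one product over the indices other than `k`: a displacement at the
    -- last index `k + 1 + i`, moduli elsewhere, and the dummy factor 1 at `k`, which makes the
    -- erasure harmless.
    have hsplit : ∀ (a : ℕ → ℝ≥0∞) (b : ℝ≥0∞),
        ∏ j ∈ (Finset.range (k + 1 + i + 1)).erase k, (if j = k then 1 else
          if j = k + 1 + i then b else a j) =
        (∏ j ∈ Finset.range k, a j) * ((∏ j ∈ Finset.range i, a (k + 1 + j)) * b) := by
      intro a b
      rw [Finset.prod_erase _ (by simp), Finset.prod_range_succ, Finset.prod_range_add,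
        Finset.prod_range_succ, mul_assoc, mul_assoc]
      congr 1
      · refine Finset.prod_congr rfl fun j hj => ?_
        have := Finset.mem_range.1 hj
        rw [if_neg (by omega), if_neg (by omega)]
      · rw [if_pos rfl, one_mul, if_neg (by omega), if_pos rfl]
        congr 1
        refine Finset.prod_congr rfl fun j hj => ?_
        have := Finset.mem_range.1 hj
        rw [if_neg (by omega), if_neg (by omega)]
    have hle := lintegral_mul_prod_eq_of_iIndepFun (X := fun k ω => (F k ω, U k ω)) hX hlaw hindep
      (k := k) (s := (Finset.range (k + 1 + i + 1)).erase k) (by simp) hφ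
      (ψ := fun j x y => if j = k then 1 else if j = k + 1 + i then sieveDisplacement p z₀ x.2 y
        else sieveModulus p x.2 y) (fun j => by
          by_cases h : j = k
          · simp only [if_pos h]
            exact measurable_const
          · by_cases h' : j = k + 1 + i
            · simpa only [if_neg h, if_pos h'] using hψ'
            · simpa only [if_neg h, if_neg h'] using hψ)
    have hone : ∀ (j : ℕ) (x : ℝ), ∫⁻ y, (if j = k then 1 else if j = k + 1 + i then
        sieveDisplacement p z₀ x y else sieveModulus p x y) ∂μ =
        if j = k then 1 else if j = k + 1 + i then Δ x else R x := fun j x => by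
      split_ifs
      · simp
      · rfl
      · rfl
    have hprod : ∀ ω, ∏ j ∈ (Finset.range (k + 1 + i + 1)).erase k, (if j = k then 1 else
        if j = k + 1 + i then sieveDisplacement p z₀ (U k ω) (F j ω, U j ω) else
          sieveModulus p (U k ω) (F j ω, U j ω)) =
        (∏ j ∈ Finset.range k, sieveModulus p (U k ω) (F j ω, U j ω)) *
        ((∏ j ∈ Finset.range i, sieveModulus p (U k ω) (F (k + 1 + j) ω, U (k + 1 + j) ω)) *
        sieveDisplacement p z₀ (U k ω) (F (k + 1 + i) ω, U (k + 1 + i) ω)) := fun ω => by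
      rw [← hsplit fun j => sieveModulus p (U k ω) (F j ω, U j ω)]
      refine Finset.prod_congr rfl fun j _ => ?_
      split_ifs with h h'
      · rfl
      · rw [h']
      · rfl
    simp only [hone, hprod, hsplit, Finset.prod_const, Finset.card_range] at hle
    rw [hle]
    have h2 : ∫⁻ f, (modulus p f + 1) ∂ν = meanModulus p ν + 1 := by
      rw [lintegral_add_left (measurable_modulus p)]
      simp [meanModulus]
    rw [← h2, ← lintegral_prod_mul ((measurable_modulus p).add_const 1).aemeasurable
        (hWRΔ i).aemeasurable]
    refine lintegral_congr fun y => ?_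
    ring
  have hexp : ∀ ω, W (U k ω) * jumpBound p z₀ (fun k => F k ω) (fun k => U k ω) k =
      W (U k ω) * displacement p z₀ (F k ω) *
        ∏ j ∈ Finset.range k, sieveModulus p (U k ω) (F j ω, U j ω) +
      ∑' i, W (U k ω) * (modulus p (F k ω) + 1) *
      ((∏ j ∈ Finset.range k, sieveModulus p (U k ω) (F j ω, U j ω)) *
      ((∏ j ∈ Finset.range i, sieveModulus p (U k ω) (F (k + 1 + j) ω, U (k + 1 + j) ω)) *
        sieveDisplacement p z₀ (U k ω) (F (k + 1 + i) ω, U (k + 1 + i) ω))) := fun ω => by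
    rw [ENNReal.tsum_mul_left, ENNReal.tsum_mul_left, jumpBound]
    ring
  simp only [hexp]
  have hm1 : Measurable fun ω => W (U k ω) * displacement p z₀ (F k ω) *
      ∏ j ∈ Finset.range k, sieveModulus p (U k ω) (F j ω, U j ω) :=
    (hWU.mul ((measurable_displacement p z₀).comp (hF k))).mul
      (Finset.measurable_prod _ fun j _ => hα j)
  rw [lintegral_add_left hm1, lintegral_tsum fun i => ?_]
  swap
  · exact ((hWU.mul (((measurable_modulus p).comp (hF k)).add_const 1)).mul
      ((Finset.measurable_prod _ fun j _ => hα _).mul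
        ((Finset.measurable_prod _ fun j _ => hα _).mul (hδ _)))).aemeasurable
  simp only [hfst, hsnd]
  rw [ENNReal.tsum_mul_left, ← lintegral_tsum fun i => (hWRΔ i).aemeasurable]
  have hlast : ∀ x, ∑' i, W x * R x ^ k * (R x ^ i * Δ x) =
      W x * R x ^ k * (meanDisplacement p z₀ ν * (1 - meanModulus p ν)⁻¹) := fun x => by
    rw [ENNReal.tsum_mul_left]
    by_cases hx : x ∈ Set.Ioc (0 : ℝ) 1
    · rw [← tsum_lintegral_sieveModulus_pow_mul z₀ h1 hx]
    · simp [hW0 x hx]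
  simp only [hlast]
  rw [lintegral_mul_const _ hWR, jumpConst]
  ring

/-- The weighted sum of the `p`-th powers of the jumps of `ζ` has a finite expectation, if the
weight is integrable with respect to `dx / x`. -/
theorem lintegral_tsum_mul_jumpBound (h1 : meanModulus p ν < 1)
    (hF : ∀ k, Measurable (F k)) (hU : ∀ k, Measurable (U k))
    (hlaw : ∀ k, P.map (fun ω => (F k ω, U k ω)) = ν.prod unitUniform)
    (hindep : iIndepFun (fun k ω => (F k ω, U k ω)) P) (z₀ : ℝ) {W : ℝ → ℝ≥0∞} (hW : Measurable W)
    (hW0 : ∀ x ∉ Set.Ioc (0 : ℝ) 1, W x = 0) :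
    ∫⁻ ω, ∑' k, W (U k ω) * jumpBound p z₀ (fun k => F k ω) (fun k => U k ω) k ∂P =
      jumpConst p z₀ ν * (1 - meanModulus p ν)⁻¹ *
        ∫⁻ x, W x * (ENNReal.ofReal x)⁻¹ ∂unitUniform := by
  have hRm : Measurable fun x => ∫⁻ y, sieveModulus p x y ∂(ν.prod unitUniform) :=
    (measurable_sieveModulus p).lintegral_prod_right'
  have hm1 : ∀ k, Measurable fun ω =>
      W (U k ω) * jumpBound p z₀ (fun k => F k ω) (fun k => U k ω) k := fun k =>
    (hW.comp (hU k)).mul (measurable_jumpBound hF hU z₀ k)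
  have hm2 : ∀ k : ℕ, Measurable fun x =>
      W x * (∫⁻ y, sieveModulus p x y ∂(ν.prod unitUniform)) ^ k := fun k =>
    hW.mul (hRm.pow_const k)
  have hm3 : Measurable fun x => W x * (ENNReal.ofReal x)⁻¹ :=
    hW.mul ENNReal.measurable_ofReal.inv
  rw [lintegral_tsum fun k => (hm1 k).aemeasurable]
  simp only [lintegral_mul_jumpBound h1 hF hU hlaw hindep z₀ hW hW0]
  rw [ENNReal.tsum_mul_left, ← lintegral_tsum fun k => (hm2 k).aemeasurable,
    mul_assoc, ← lintegral_const_mul _ hm3]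
  congr 1
  refine lintegral_congr fun x => ?_
  -- Summing `R x ^ k` over `k` produces the `1 / x`, with no displacement left to cancel it.
  rw [ENNReal.tsum_mul_left]
  by_cases hx : x ∈ Set.Ioc (0 : ℝ) 1
  · rw [tsum_lintegral_sieveModulus_pow h1 hx]
    ring
  · simp [hW0 x hx]

end iid

/-! ### The stochastic integrals -/

theorem summable_norm_of_tsum_enorm_rpow_ne_top {ι : Type*} {t : ι → ℝ} {p : ℝ} (hp0 : 0 < p)
    (hp1 : p ≤ 1) (h : ∑' i, ‖t i‖ₑ ^ p ≠ ∞) : Summable fun i => ‖t i‖ := by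
  have h1 : ∑' i, ‖t i‖ₑ ≠ ∞ := ne_top_of_le_ne_top
    (ENNReal.rpow_ne_top_of_nonneg (inv_nonneg.2 hp0.le) h)
    (by simpa using ENNReal.tsum_le_tsum_rpow (fun i => ‖t i‖ₑ) hp0 hp1)
  exact tsum_enorm_ne_top_iff_summable_norm.1 h1

theorem enorm_tsum_rpow_le {ι : Type*} (t : ι → ℝ) {p : ℝ} (hp0 : 0 < p) (hp1 : p ≤ 1) :
    ‖∑' i, t i‖ₑ ^ p ≤ ∑' i, ‖t i‖ₑ ^ p :=
  (ENNReal.rpow_le_rpow enorm_tsum_le_tsum_enorm hp0.le).trans (ENNReal.rpow_tsum_le _ hp0 hp1)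

theorem ofReal_abs_rpow {p : ℝ} (hp0 : 0 < p) (y : ℝ) : ENNReal.ofReal (|y| ^ p) = ‖y‖ₑ ^ p := by
  rw [Real.enorm_eq_ofReal_abs, ENNReal.ofReal_rpow_of_nonneg (abs_nonneg _) hp0.le]

/-- The weight `|h| ^ p` on the set `s`. -/
noncomputable def weight (p : ℝ) (h : ℝ → ℝ) (s : Set ℝ) : ℝ → ℝ≥0∞ :=
  s.indicator fun x => ‖h x‖ₑ ^ p

section pathwiseIntegral

variable {p z₀ : ℝ} {f : ℕ → LipFun} {u : ℕ → ℝ}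

/-- A path for which `ζ` is regular, with distinct points in `(0, 1]`. -/
structure IsGoodPath (p z₀ : ℝ) (f : ℕ → LipFun) (u : ℕ → ℝ) : Prop where
  regular : ∀ x ∈ Set.Ioc (0 : ℝ) 1, IsRegularAt p z₀ f u x
  injective : Function.Injective u
  mem : ∀ k, u k ∈ Set.Ioc (0 : ℝ) 1

variable {h : ℝ → ℝ}

theorem IsGoodPath.enorm_indicator_rpow_le (hg : IsGoodPath p z₀ f u) (hp0 : 0 < p) (hp1 : p ≤ 1)
    (s : Set ℝ) (k : ℕ) :
    ‖s.indicator (fun y => h y * zetaJump f u z₀ y) (u k)‖ₑ ^ p ≤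
      weight p h s (u k) * jumpBound p z₀ f u k := by
  by_cases hk : u k ∈ s
  · rw [weight, Set.indicator_of_mem hk, Set.indicator_of_mem hk, enorm_mul,
      ENNReal.mul_rpow_of_nonneg _ _ hp0.le]
    gcongr
    exact (hg.regular _ (hg.mem k)).enorm_zetaJump_rpow_le hp0 hp1 hg.injective
  · simp [Set.indicator_of_notMem hk, hp0]

theorem IsGoodPath.summable_norm (hg : IsGoodPath p z₀ f u) (hp0 : 0 < p) (hp1 : p ≤ 1)
    (hs : ∑' k, weight p h (Set.Ioc 0 1) (u k) * jumpBound p z₀ f u k ≠ ∞) {a b : ℝ} (ha : 0 ≤ a)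
    (hb : b ≤ 1) :
    Summable fun k => ‖(Set.Ioc a b).indicator (fun y => h y * zetaJump f u z₀ y) (u k)‖ := by
  refine summable_norm_of_tsum_enorm_rpow_ne_top hp0 hp1 (ne_top_of_le_ne_top hs ?_)
  refine ENNReal.tsum_le_tsum fun k => (hg.enorm_indicator_rpow_le hp0 hp1 _ k).trans ?_
  gcongr
  exact Set.indicator_le_indicator_of_subset (Set.Ioc_subset_Ioc ha hb) (fun _ => zero_le) _

theorem IsGoodPath.enorm_integralDZeta_rpow_le (hg : IsGoodPath p z₀ f u) (hp0 : 0 < p)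
    (hp1 : p ≤ 1) (a b : ℝ) :
    ‖integralDZeta f u z₀ h a b‖ₑ ^ p ≤
      ∑' k, weight p h (Set.Ioc a b) (u k) * jumpBound p z₀ f u k :=
  (enorm_tsum_rpow_le _ hp0 hp1).trans
    (ENNReal.tsum_le_tsum fun k => hg.enorm_indicator_rpow_le hp0 hp1 _ k)

theorem IsGoodPath.integralDZeta_sub (hg : IsGoodPath p z₀ f u) (hp0 : 0 < p) (hp1 : p ≤ 1)
    (hs : ∑' k, weight p h (Set.Ioc 0 1) (u k) * jumpBound p z₀ f u k ≠ ∞) {a b : ℝ} (ha : 0 ≤ a)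
    (hab : a ≤ b) (hb : b ≤ 1) :
    integralDZeta f u z₀ h 0 b - integralDZeta f u z₀ h a b = integralDZeta f u z₀ h 0 a := by
  unfold integralDZeta
  rw [← (hg.summable_norm hp0 hp1 hs le_rfl hb).of_norm.tsum_sub
    (hg.summable_norm hp0 hp1 hs ha hb).of_norm]
  refine tsum_congr fun k => ?_
  rw [← Set.Ioc_union_Ioc_eq_Ioc ha hab, Set.indicator_union_of_disjoint]
  · simp
  · exact Set.Ioc_disjoint_Ioc_of_le le_rfl

/-- Dominated convergence for series: every `u k` is positive, so each term is constant once `a < u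
k`. -/
theorem IsGoodPath.tendsto_integralDZeta (hg : IsGoodPath p z₀ f u) (hp0 : 0 < p) (hp1 : p ≤ 1)
    (hs : ∑' k, weight p h (Set.Ioc 0 1) (u k) * jumpBound p z₀ f u k ≠ ∞) {b : ℝ} (hb : b ≤ 1) :
    Tendsto (fun a => integralDZeta f u z₀ h a b) (𝓝[>] 0) (𝓝 (integralDZeta f u z₀ h 0 b)) := by
  refine tendsto_tsum_of_dominated_convergence (hg.summable_norm hp0 hp1 hs le_rfl hb)
    (fun k => tendsto_const_nhds.congr' ?_) ?_
  · filter_upwards [Ioo_mem_nhdsGT (hg.mem k).1] with a ha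
    have : u k ∈ Set.Ioc a b ↔ u k ∈ Set.Ioc 0 b :=
      ⟨fun h => ⟨ha.1.trans h.1, h.2⟩, fun h => ⟨ha.2, h.2⟩⟩
    simp only [Set.indicator, this]
  · filter_upwards [self_mem_nhdsWithin] with a ha k
    exact norm_indicator_le_of_subset (Set.Ioc_subset_Ioc_left (le_of_lt ha)) _ _

end pathwiseIntegral

/-! ### The weight `|h| ^ p` and the behaviour of `h` at 0. -/

section weight

variable {p : ℝ} {h : ℝ → ℝ}

theorem measurable_indicator_of_continuousOn (hcont : ContinuousOn h (Set.Icc 0 1)) {a b : ℝ}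
    (ha : 0 ≤ a) (hb : b ≤ 1) : Measurable ((Set.Ioc a b).indicator h) := by
  have h1 : ContinuousOn h (Set.Ioc a b) := hcont.mono fun x hx =>
    ⟨ha.trans hx.1.le, hx.2.trans hb⟩
  rw [← Set.piecewise_eq_indicator]
  exact h1.measurable_piecewise continuousOn_const measurableSet_Ioc

theorem measurable_weight (hp0 : 0 < p) (hcont : ContinuousOn h (Set.Icc 0 1)) {a b : ℝ}
    (ha : 0 ≤ a) (hb : b ≤ 1) : Measurable (weight p h (Set.Ioc a b)) := by
  have h1 := (measurable_indicator_of_continuousOn hcont ha hb).enorm.pow_const p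
  convert h1 using 1
  ext x
  by_cases hx : x ∈ Set.Ioc a b
  · simp [weight, hx]
  · simp [weight, Set.indicator_of_notMem hx, hp0]

theorem lintegral_enorm_rpow_mul_inv_ne_top (hp0 : 0 < p)
    (hint : IntegrableOn (fun t => |h t| ^ p * t⁻¹) (Set.Ioc 0 1)) :
    ∫⁻ x, ‖h x‖ₑ ^ p * (ENNReal.ofReal x)⁻¹ ∂unitUniform ≠ ∞ := by
  have h1 : ∫⁻ x in Set.Ioc (0 : ℝ) 1, ‖|h x| ^ p * x⁻¹‖ₑ ≠ ∞ := hint.2.ne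
  rw [unitUniform, ← restrict_Ioc_eq_restrict_Icc]
  convert h1 using 1
  refine setLIntegral_congr_fun measurableSet_Ioc fun x hx => ?_
  rw [enorm_mul, Real.enorm_of_nonneg (inv_nonneg.2 hx.1.le), ENNReal.ofReal_inv_of_pos hx.1,
    Real.enorm_of_nonneg (Real.rpow_nonneg (abs_nonneg _) _), ofReal_abs_rpow hp0]

theorem lintegral_weight_mul (a b : ℝ) :
    ∫⁻ x, weight p h (Set.Ioc a b) x * (ENNReal.ofReal x)⁻¹ ∂unitUniform =
      ∫⁻ x in Set.Ioc a b, ‖h x‖ₑ ^ p * (ENNReal.ofReal x)⁻¹ ∂unitUniform := by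
  rw [← lintegral_indicator measurableSet_Ioc]
  refine lintegral_congr fun x => ?_
  rw [weight, Set.indicator_mul_left]

theorem tendsto_lintegral_weight_mul (hp0 : 0 < p)
    (hint : IntegrableOn (fun t => |h t| ^ p * t⁻¹) (Set.Ioc 0 1)) :
    Tendsto (fun a => ∫⁻ x, weight p h (Set.Ioc 0 a) x * (ENNReal.ofReal x)⁻¹ ∂unitUniform)
      (𝓝[>] 0) (𝓝 0) := by
  simp only [lintegral_weight_mul]
  refine tendsto_setLIntegral_zero (lintegral_enorm_rpow_mul_inv_ne_top hp0 hint) ?_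
  have h1 : Tendsto (fun a : ℝ => ENNReal.ofReal a) (𝓝[>] 0) (𝓝 0) := by
    have := (ENNReal.continuous_ofReal.tendsto 0).mono_left (nhdsWithin_le_nhds (s := Set.Ioi 0))
    simpa using this
  refine tendsto_of_tendsto_of_tendsto_of_le_of_le tendsto_const_nhds h1 (fun _ => zero_le)
    fun a => ?_
  refine (Measure.restrict_apply_le _ _).trans ?_
  simp

/-- A continuous function for which `|h| ^ p / t` is integrable vanishes at `0`. -/
theorem eq_zero_of_integrableOn_rpow_mul_inv (hp0 : 0 < p) (hcont : ContinuousOn h (Set.Icc 0 1))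
    (hint : IntegrableOn (fun t => |h t| ^ p * t⁻¹) (Set.Ioc 0 1)) : h 0 = 0 := by
  by_contra h0
  have hc : ContinuousWithinAt (fun t => |h t| ^ p) (Set.Icc 0 1) 0 :=
    ((hcont 0 (by simp)).abs).rpow_const (Or.inr hp0.le)
  have hpos : 0 < |h 0| ^ p := Real.rpow_pos_of_pos (abs_pos.2 h0) p
  have hev : ∀ᶠ t in 𝓝[Set.Icc 0 1] (0 : ℝ), |h 0| ^ p / 2 < |h t| ^ p :=
    hc.eventually (lt_mem_nhds (by linarith))
  obtain ⟨ε, hε, hε'⟩ := Metric.mem_nhdsWithin_iff.1 hev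
  -- Halving keeps `(0, d]` inside the open ball, and the minimum with 1 keeps it in the domain;
  -- there `|h| ^ p` is bounded below, so `1 / t` would be integrable at 0.
  set d := min (ε / 2) 1 with hd
  have hd0 : 0 < d := by positivity
  have h1 : IntegrableOn (fun t : ℝ => t⁻¹) (Set.Ioc 0 d) := by
    refine Integrable.mono' ((hint.mono_set (Set.Ioc_subset_Ioc_right (min_le_right _ _))).const_mul
      (|h 0| ^ p / 2)⁻¹) measurable_inv.aestronglyMeasurable ?_
    filter_upwards [ae_restrict_mem measurableSet_Ioc] with t ht
    have ht1 : t ≤ ε / 2 := ht.2.trans (min_le_left _ _)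
    have ht2 : t ≤ 1 := ht.2.trans (min_le_right _ _)
    have h2 : |h 0| ^ p / 2 < |h t| ^ p := by
      refine hε' ⟨?_, ht.1.le, ht2⟩
      rw [Metric.mem_ball, Real.dist_eq, sub_zero, abs_of_pos ht.1]
      linarith
    have ht0 : 0 < t⁻¹ := inv_pos.2 ht.1
    rw [Real.norm_of_nonneg ht0.le, ← mul_assoc]
    refine le_mul_of_one_le_left ht0.le ?_
    rw [inv_mul_eq_div, one_le_div (by positivity)]
    exact h2.le
  have h2 := (intervalIntegrable_iff_integrableOn_Ioc_of_le hd0.le).2 h1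
  rw [intervalIntegrable_inv_iff] at h2
  rcases h2 with h2 | h2
  · exact hd0.ne h2
  · exact h2 Set.left_mem_uIcc

end weight

section integrals

variable {Ω : Type*} [MeasurableSpace Ω] {P : Measure Ω}
  {F : ℕ → Ω → LipFun} {U : ℕ → Ω → ℝ} {p z₀ : ℝ} {h : ℝ → ℝ}

theorem aestronglyMeasurable_zeta (hF : ∀ k, Measurable (F k)) (hU : ∀ k, Measurable (U k))
    (hp0 : 0 < p) (hp1 : p ≤ 1) {x : ℝ}
    (hreg : ∀ᵐ ω ∂P, IsRegularAt p z₀ (fun k => F k ω) (fun k => U k ω) x) :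
    AEStronglyMeasurable (fun ω => zeta (fun k => F k ω) (fun k => U k ω) z₀ x) P :=
  aestronglyMeasurable_of_tendsto_ae atTop
    (fun n => (measurable_backIter hF hU measurable_const n z₀).aestronglyMeasurable)
    (hreg.mono fun _ h => h.tendsto_zeta hp0 hp1)

/-- The jump at the random point `U k` is an almost sure limit of differences of measurable
iterates, so joint measurability of `ζ` in `(ω, x)` is not required. -/
theorem aestronglyMeasurable_integralDZeta (hF : ∀ k, Measurable (F k))
    (hU : ∀ k, Measurable (U k)) (hp0 : 0 < p) (hp1 : p ≤ 1)
    (hgood : ∀ᵐ ω ∂P, IsGoodPath p z₀ (fun k => F k ω) (fun k => U k ω))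
    (hsum : ∀ᵐ ω ∂P, ∑' k, weight p h (Set.Ioc 0 1) (U k ω) *
      jumpBound p z₀ (fun k => F k ω) (fun k => U k ω) k ≠ ∞)
    (hcont : ContinuousOn h (Set.Icc 0 1)) {a b : ℝ} (ha : 0 ≤ a) (hb : b ≤ 1) :
    AEStronglyMeasurable
      (fun ω => integralDZeta (fun k => F k ω) (fun k => U k ω) z₀ h a b) P := by
  refine aestronglyMeasurable_of_tendsto_ae atTop (f := fun n ω => ∑ k ∈ Finset.range n,
    (Set.Ioc a b).indicator (fun y => h y * zetaJump (fun k => F k ω) (fun k => U k ω) z₀ y)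
      (U k ω)) (fun n => ?_) ?_
  · refine Finset.aestronglyMeasurable_fun_sum _ fun k _ => ?_
    have h1 : AEStronglyMeasurable
        (fun ω => zetaJump (fun k => F k ω) (fun k => U k ω) z₀ (U k ω)) P := by
      refine aestronglyMeasurable_of_tendsto_ae atTop (fun n =>
        ((measurable_backIter hF hU (hU k) n z₀).sub
          (measurable_backIterLeft hF hU (hU k) n z₀)).aestronglyMeasurable) ?_
      exact hgood.mono fun ω hω => (hω.regular _ (hω.mem k)).tendsto_zetaJump hp0 hp1
    have h2 := (((measurable_indicator_of_continuousOn hcont ha hb).comp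
      (hU k)).aestronglyMeasurable (μ := P)).mul h1
    refine h2.congr (Eventually.of_forall fun ω => ?_)
    simp only [Pi.mul_apply, Function.comp_apply]
    by_cases hk : U k ω ∈ Set.Ioc a b <;> simp [Set.indicator, hk]
  · filter_upwards [hgood, hsum] with ω hω hs
    exact (hω.summable_norm hp0 hp1 hs ha hb).of_norm.hasSum.tendsto_sum_nat

theorem memLp_ofReal_of_lintegral_ne_top {X : Ω → ℝ} (hp0 : 0 < p)
    (hX : AEStronglyMeasurable X P) (hfin : ∫⁻ ω, ‖X ω‖ₑ ^ p ∂P ≠ ∞) :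
    MemLp X (ENNReal.ofReal p) P := by
  refine ⟨hX, ?_⟩
  rw [eLpNorm_lt_top_iff_lintegral_rpow_enorm_lt_top (by simpa using hp0) ENNReal.ofReal_ne_top,
    ENNReal.toReal_ofReal hp0.le]
  exact hfin.lt_top

end integrals

theorem mainTheorem12
    (ν : Measure LipFun) [IsProbabilityMeasure ν]
    (hL : Integrable (fun f : LipFun => f.L) ν)
    (hz : ∃ z : ℝ, Integrable (fun f : LipFun => f z - z) ν)
    {Ω : Type*} [MeasurableSpace Ω] (P : Measure Ω) [IsProbabilityMeasure P]
    (F : ℕ → Ω → LipFun) (U : ℕ → Ω → ℝ)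
    (hF : ∀ k, Measurable (F k)) (hU : ∀ k, Measurable (U k))
    (hlaw : ∀ k, P.map (fun ω => (F k ω, U k ω)) =
      ν.prod (volume.restrict (Set.Icc (0 : ℝ) 1)))
    (hindep : iIndepFun (fun k ω => (F k ω, U k ω)) P)
    (z₀ : ℝ)
    (p : ℝ) (hp0 : 0 < p) (hp1 : p ≤ 1)
    (hΦ : ∫ f : LipFun, f.L ^ p ∂ν < 1)
    (h : ℝ → ℝ) (hcont : ContinuousOn h (Set.Icc 0 1))
    (hint : IntegrableOn (fun t => |h t| ^ p * t⁻¹) (Set.Ioc 0 1)) :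
    (∀ᵐ ω ∂P, ∀ x ∈ Set.Ioc (0 : ℝ) 1,
      Tendsto (fun n => backIter (fun k => F k ω) (fun k => U k ω) x n z₀) atTop
        (𝓝 (zeta (fun k => F k ω) (fun k => U k ω) z₀ x)) ∧
      ∃ l : ℝ, Tendsto (zeta (fun k => F k ω) (fun k => U k ω) z₀) (𝓝[<] x) (𝓝 l)) ∧
    (∀ᵐ ω ∂P, ∀ a ∈ Set.Ioc (0 : ℝ) 1,
      Summable (fun k => (Set.Ioc a 1).indicator
        (fun y => |h y * zetaJump (fun k => F k ω) (fun k => U k ω) z₀ y|) (U k ω))) ∧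
    ∀ b ∈ Set.Ioc (0 : ℝ) 1,
      (∃ I : Ω → ℝ,
        (∀ᵐ ω ∂P, Tendsto
          (fun a => integralDZeta (fun k => F k ω) (fun k => U k ω) z₀ h a b)
          (𝓝[>] 0) (𝓝 (I ω))) ∧
        TendstoLpAtZero P p
          (fun a ω => integralDZeta (fun k => F k ω) (fun k => U k ω) z₀ h a b) I) ∧
      (∃ J : Ω → ℝ,
        TendstoLpAtZero P p
          (fun a ω => integralZetaD (fun k => F k ω) (fun k => U k ω) z₀ h a b) J) := by
  have hp1' := meanModulus_lt_one hp0 hp1 hL hΦ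
  have hD := meanDisplacement_ne_top z₀ hp0 hp1 hp1' hz
  have hC : (1 - meanModulus p ν)⁻¹ ≠ ∞ := ENNReal.inv_ne_top.2 (tsub_pos_of_lt hp1').ne'
  have hK : jumpConst p z₀ ν * (1 - meanModulus p ν)⁻¹ ≠ ∞ :=
    ENNReal.mul_ne_top (jumpConst_ne_top hp1' hD) hC
  have hreg := ae_isRegularAt hp0 hp1 hp1' hz hF hU hlaw hindep z₀
  have hgood : ∀ᵐ ω ∂P, IsGoodPath p z₀ (fun k => F k ω) (fun k => U k ω) := by
    filter_upwards [hreg, ae_injective_of_iIndepFun hF hU hlaw hindep,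
      ae_mem_Ioc_of_map_eq hF hU hlaw] with ω h1 h2 h3 using ⟨h1, h2, h3⟩
  have hregx : ∀ x ∈ Set.Ioc (0 : ℝ) 1, ∀ᵐ ω ∂P,
      IsRegularAt p z₀ (fun k => F k ω) (fun k => U k ω) x :=
    fun x hx => hreg.mono fun ω hω => hω x hx
  set K := jumpConst p z₀ ν * (1 - meanModulus p ν)⁻¹ with hKdef
  have hmean : ∀ a b : ℝ, 0 ≤ a → b ≤ 1 →
      ∫⁻ ω, ∑' k, weight p h (Set.Ioc a b) (U k ω) *
        jumpBound p z₀ (fun k => F k ω) (fun k => U k ω) k ∂P =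
      K * ∫⁻ x, weight p h (Set.Ioc a b) x * (ENNReal.ofReal x)⁻¹ ∂unitUniform :=
    fun a b ha hb => lintegral_tsum_mul_jumpBound hp1' hF hU hlaw hindep z₀
      (measurable_weight hp0 hcont ha hb) fun x hx =>
        Set.indicator_of_notMem (fun h' => hx (Set.Ioc_subset_Ioc ha hb h')) _
  have hfin : ∀ a b : ℝ, ∫⁻ x, weight p h (Set.Ioc a b) x * (ENNReal.ofReal x)⁻¹ ∂unitUniform ≠ ∞ :=
    fun a b => by
      rw [lintegral_weight_mul]
      exact ne_top_of_le_ne_top (lintegral_enorm_rpow_mul_inv_ne_top hp0 hint)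
        (setLIntegral_le_lintegral _ _)
  have hsum : ∀ᵐ ω ∂P, ∑' k, weight p h (Set.Ioc 0 1) (U k ω) *
      jumpBound p z₀ (fun k => F k ω) (fun k => U k ω) k ≠ ∞ := by
    have hm : Measurable fun ω => ∑' k, weight p h (Set.Ioc 0 1) (U k ω) *
        jumpBound p z₀ (fun k => F k ω) (fun k => U k ω) k :=
      Measurable.tsum fun k => ((measurable_weight hp0 hcont le_rfl le_rfl).comp (hU k)).mul
        (measurable_jumpBound hF hU z₀ k)
    have h2 := hmean 0 1 le_rfl le_rfl ▸ ENNReal.mul_ne_top hK (hfin 0 1)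
    filter_upwards [ae_lt_top hm h2] with ω hω using hω.ne
  have hmeasI : ∀ a b : ℝ, 0 ≤ a → b ≤ 1 → AEStronglyMeasurable
      (fun ω => integralDZeta (fun k => F k ω) (fun k => U k ω) z₀ h a b) P :=
    fun a b ha hb => aestronglyMeasurable_integralDZeta hF hU hp0 hp1 hgood hsum hcont ha hb
  have hIle : ∀ a b : ℝ, 0 ≤ a → b ≤ 1 →
      ∫⁻ ω, ‖integralDZeta (fun k => F k ω) (fun k => U k ω) z₀ h a b‖ₑ ^ p ∂P ≤
      K * ∫⁻ x, weight p h (Set.Ioc a b) x * (ENNReal.ofReal x)⁻¹ ∂unitUniform :=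
    fun a b ha hb => (lintegral_mono_ae (hgood.mono fun ω hω =>
      hω.enorm_integralDZeta_rpow_le hp0 hp1 a b)).trans_eq (hmean a b ha hb)
  have hmemI : ∀ a b : ℝ, 0 ≤ a → b ≤ 1 → MemLp
      (fun ω => integralDZeta (fun k => F k ω) (fun k => U k ω) z₀ h a b) (ENNReal.ofReal p) P :=
    fun a b ha hb => memLp_ofReal_of_lintegral_ne_top hp0 (hmeasI a b ha hb)
      (ne_top_of_le_ne_top (ENNReal.mul_ne_top hK (hfin a b)) (hIle a b ha hb))
  -- The integral over `(0, a]` is the error in both `L^p` statements; it vanishes by absolute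
  -- continuity of `∫ |h|^p dx / x`.
  have hI0 : Tendsto (fun a => ∫⁻ ω,
      ‖integralDZeta (fun k => F k ω) (fun k => U k ω) z₀ h 0 a‖ₑ ^ p ∂P) (𝓝[>] 0) (𝓝 0) := by
    have h1 := ENNReal.Tendsto.const_mul (tendsto_lintegral_weight_mul hp0 hint) (Or.inr hK)
    rw [mul_zero] at h1
    refine tendsto_of_tendsto_of_tendsto_of_le_of_le' tendsto_const_nhds h1
      (Eventually.of_forall fun _ => zero_le) ?_
    filter_upwards [Ioo_mem_nhdsGT zero_lt_one] with a ha using hIle 0 a le_rfl ha.2.le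
  -- A bound for the `p`-th moment of `ζ(x)` independent of `x`: as `a ↓ 0` only boundedness of
  -- `ζ(a)` in `L^p` is used, and the decay comes from `h a`.
  set M := meanDisplacement p z₀ ν * (1 - meanModulus p ν)⁻¹ + ‖z₀‖ₑ ^ p with hM
  have hMtop : M ≠ ∞ := ENNReal.add_ne_top.2 ⟨ENNReal.mul_ne_top hD hC,
    ENNReal.rpow_ne_top_of_nonneg hp0.le enorm_ne_top⟩
  have hζle : ∀ x ∈ Set.Ioc (0 : ℝ) 1,
      ∫⁻ ω, ‖zeta (fun k => F k ω) (fun k => U k ω) z₀ x‖ₑ ^ p ∂P ≤ M := fun x hx => by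
    calc ∫⁻ ω, ‖zeta (fun k => F k ω) (fun k => U k ω) z₀ x‖ₑ ^ p ∂P
        ≤ ∫⁻ ω, (‖zeta (fun k => F k ω) (fun k => U k ω) z₀ x - z₀‖ₑ ^ p + ‖z₀‖ₑ ^ p) ∂P :=
          lintegral_mono fun ω => by
            simpa using enorm_sub_rpow_triangle
              (zeta (fun k => F k ω) (fun k => U k ω) z₀ x) z₀ 0 hp0 hp1
      _ = ∫⁻ ω, ‖zeta (fun k => F k ω) (fun k => U k ω) z₀ x - z₀‖ₑ ^ p ∂P + ‖z₀‖ₑ ^ p := by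
          rw [lintegral_add_right _ measurable_const]
          simp
      _ ≤ M := by
          exact add_le_add (lintegral_enorm_zeta_sub_rpow_le hp0 hp1 hp1' hF hU hlaw hindep hx
            (hregx x hx)) le_rfl
  have hmemζ : ∀ x ∈ Set.Ioc (0 : ℝ) 1, ∀ c : ℝ, MemLp
      (fun ω => zeta (fun k => F k ω) (fun k => U k ω) z₀ x * c) (ENNReal.ofReal p) P :=
    fun x hx c => (memLp_ofReal_of_lintegral_ne_top hp0
      (aestronglyMeasurable_zeta hF hU hp0 hp1 (hregx x hx))
      (ne_top_of_le_ne_top hMtop (hζle x hx))).mul_const c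
  refine ⟨?_, ?_, fun b hb => ⟨?_, ?_⟩⟩
  · filter_upwards [hreg] with ω hω x hx
    obtain ⟨l, -, hl⟩ := (hω x hx).exists_tendsto_left hp0 hp1
    exact ⟨(hω x hx).tendsto_zeta hp0 hp1, l, hl⟩
  · filter_upwards [hgood, hsum] with ω hω hs a ha
    refine (hω.summable_norm hp0 hp1 hs ha.1.le le_rfl).congr fun k => ?_
    rw [norm_indicator_eq_indicator_norm]
    rfl
  -- The limit is the series over all of `(0, b]`, obtained by setting `a = 0`.
  · refine ⟨fun ω => integralDZeta (fun k => F k ω) (fun k => U k ω) z₀ h 0 b, ?_, ?_, ?_, ?_⟩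
    · filter_upwards [hgood, hsum] with ω hω hs using hω.tendsto_integralDZeta hp0 hp1 hs hb.2
    · filter_upwards [self_mem_nhdsWithin] with a ha using hmemI a b (le_of_lt ha) hb.2
    · exact hmemI 0 b le_rfl hb.2
    · refine hI0.congr' ?_
      filter_upwards [Ioo_mem_nhdsGT hb.1] with a ha
      refine lintegral_congr_ae ?_
      filter_upwards [hgood, hsum] with ω hω hs
      rw [ofReal_abs_rpow hp0, ← hω.integralDZeta_sub hp0 hp1 hs ha.1.le ha.2.le hb.2, ← enorm_neg,
        neg_sub]
  -- The boundary term at 0 is dropped, so the error is the integral over `(0, a]` minus `ζ(a)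
  -- h(a)`.
  · refine ⟨fun ω => zeta (fun k => F k ω) (fun k => U k ω) z₀ b * h b -
      integralDZeta (fun k => F k ω) (fun k => U k ω) z₀ h 0 b, ?_, ?_, ?_⟩
    · filter_upwards [Ioo_mem_nhdsGT zero_lt_one] with a ha
      exact ((hmemζ b hb _).sub (hmemζ a ⟨ha.1, ha.2.le⟩ _)).sub (hmemI a b ha.1.le hb.2)
    · exact (hmemζ b hb _).sub (hmemI 0 b le_rfl hb.2)
    · have hh : Tendsto (fun a => M * ‖h a‖ₑ ^ p) (𝓝[>] 0) (𝓝 0) := by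
        have h1 : Tendsto h (𝓝[>] 0) (𝓝 (h 0)) := by
          refine (hcont 0 (by simp)).mono_left ?_
          rw [← nhdsWithin_Ioo_eq_nhdsGT (zero_lt_one' ℝ)]
          exact nhdsWithin_mono _ Set.Ioo_subset_Icc_self
        have h2 := ENNReal.Tendsto.const_mul (h1.enorm.ennrpow_const p) (Or.inr hMtop)
        simpa [eq_zero_of_integrableOn_rpow_mul_inv hp0 hcont hint, hp0] using h2
      have hsum0 := hI0.add hh
      rw [add_zero] at hsum0
      refine tendsto_of_tendsto_of_tendsto_of_le_of_le' tendsto_const_nhds hsum0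
        (Eventually.of_forall fun _ => zero_le) ?_
      filter_upwards [Ioo_mem_nhdsGT hb.1] with a ha
      have ha' : a ∈ Set.Ioc (0 : ℝ) 1 := ⟨ha.1, ha.2.le.trans hb.2⟩
      calc ∫⁻ ω, ENNReal.ofReal (|integralZetaD (fun k => F k ω) (fun k => U k ω) z₀ h a b -
            (zeta (fun k => F k ω) (fun k => U k ω) z₀ b * h b -
              integralDZeta (fun k => F k ω) (fun k => U k ω) z₀ h 0 b)| ^ p) ∂P
          ≤ ∫⁻ ω, (‖integralDZeta (fun k => F k ω) (fun k => U k ω) z₀ h 0 a‖ₑ ^ p +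
              ‖zeta (fun k => F k ω) (fun k => U k ω) z₀ a‖ₑ ^ p * ‖h a‖ₑ ^ p) ∂P := by
            refine lintegral_mono_ae ?_
            filter_upwards [hgood, hsum] with ω hω hs
            rw [ofReal_abs_rpow hp0, ← ENNReal.mul_rpow_of_nonneg _ _ hp0.le, ← enorm_mul]
            refine le_trans (le_of_eq ?_) (enorm_sub_rpow_le_add _ _ hp0 hp1)
            rw [← hω.integralDZeta_sub hp0 hp1 hs ha.1.le ha.2.le hb.2, integralZetaD]
            congr 2
            ring
        _ = ∫⁻ ω, ‖integralDZeta (fun k => F k ω) (fun k => U k ω) z₀ h 0 a‖ₑ ^ p ∂P +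
              (∫⁻ ω, ‖zeta (fun k => F k ω) (fun k => U k ω) z₀ a‖ₑ ^ p ∂P) * ‖h a‖ₑ ^ p := by
            rw [lintegral_add_left' ((hmeasI 0 a le_rfl ha'.2).enorm.pow_const p),
              lintegral_mul_const'' _ ((aestronglyMeasurable_zeta hF hU hp0 hp1
                (hregx a ha')).enorm.pow_const p)]
        _ ≤ _ := by
            exact add_le_add le_rfl (mul_le_mul' (hζle a ha') le_rfl)
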